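/- Let $V$ be a finite set. A *directed ancestral graph* on $V$ is a simple graph with arrows $i\to j$ and arcs $i\leftrightarrow j$ that has no directed cycle and no arc one endpoint of which is an ancestor of the other; $\mathrm{an}(i)$ is the set of ancestors of $i$ (nodes $k\neq i$ with a directed path from $k$ to $i$), and $\mathrm{an}(i,j)=(\mathrm{an}(i)\cup\mathrm{an}(j))\setminus\{i,j\}$. It is a *DAG* if it has no arcs. The skeleton $\mathrm{sk}(G)$ is obtained by removing all arrowheads. An inner node of a path is a *collider* if both path edges at it have an arrowhead at it. For pairwise disjoint $A,B,C\subseteq V$, the triple $\langle A,B\mid C\rangle$ belongs to $\mathcal J(G)$ if there is no path from $A$ to $B$ all of whose colliders are in $C$ or ancestors of nodes in $C$ and all of whose other inner nodes are outside $C$. $G$ is *maximal* if any two distinct non-adjacent nodes $i,j$ satisfy $\langle i,j\mid C\rangle\in\mathcal J(G)$ for some $C$; $G,H$ are *Markov equivalent* if $\mathcal J(G)=\mathcal J(H)$. Let $P$ be a joint probability distribution of random variables $(X_v)_{v\in V}$, and let $\mathcal J(P)$ be the set of triples $\langle A,B\mid C\rangle$ of pairwise disjoint subsets of $V$ such that $X_A$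 is conditionally independent of $X_B$ given $X_C$; write $i\perp\!\!\!\perp j\mid C$ for $\langle \{i\},\{j\}\mid C\rangle\in\mathcal J(P)$. The skeleton $\mathrm{sk}(P)$ is the undirected graph on $V$ in which distinct $i,j$ are adjacent iff $i\perp\!\!\!\perp j\mid C$ for no $C\subseteq V\setminus\{i,j\}$. With respect to a directed ancestral graph $G$, where $i<k$ means $k\in\mathrm{an}(i)$, we say that: * $P$ is *Markovian* to $G$ if $\mathcal J(G)\subseteq\mathcal J(P)$, and *converse pairwise Markovian* to $G$ if $i\perp\!\!\!\perp j\mid \mathrm{an}(i,j)$ implies that $i,j$ are not adjacent in $G$; * $P$ satisfies *ordered upward-stability* if $i\perp\!\!\!\perp j\mid C$ implies $i\perp\!\!\!\perp j\mid C\cup\{k\}$ for every $k\in V\setminus\{i,j\}$ with $i<k$ or $j<k$, and *ordered downward-stability* if $i\perp\!\!\!\perp j\mid C$ implies $i\perp\!\!\!\perp j\mid C\setminus\{k\}$ for every $k\in V\setminus\{i,j\}$ with $i\nless k$, $j\nless k$ and $l\nless k$ for all $l\in C\setminus\{k\}$; * $G$ is an *output of a natural structure-learning algorithm* (for $P$)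 if $\mathrm{sk}(G)=\mathrm{sk}(P)$ and $P$ satisfies ordered upward- and downward-stability with respect to $G$. $P$ is *path-stable* if there are no path $\langle i,i_1,\dots,i_r,k,j\rangle$ ($r\ge 0$) in $\mathrm{sk}(P)$ with $i\not\sim j$ and $i_1,\dots,i_r$ all adjacent to $j$, and no set $C$ disjoint from $\{i,j,k\}$, such that both $i\perp\!\!\!\perp j\mid U\cup C$ and $i\perp\!\!\!\perp j\mid U\cup C\cup\{k\}$, where $U=\{i_1,\dots,i_r\}$. $P$ is *V-stable* if this holds for the paths with $r=0$. **Theorem.** Let $G_0$ be a directed ancestral graph on $V$. Suppose that $P$ is Markovian and converse pairwise Markovian to $G_0$ and satisfies ordered upward- and downward-stability with respect to $G_0$. (a) If $G_0$ is maximal and $P$ is path-stable, then every maximal output $G(P)$ of a natural structure-learning algorithm is Markov equivalent to $G_0$. (b) If $G_0$ is a DAG and $P$ is V-stable, then every DAG output $G(P)$ of a natural structure-learning algorithm is Markov equivalent to $G_0$. -/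

import Mathlib

open MeasureTheory

/-- An independence model over `V`: a set of triples `⟨A, B | C⟩` of pairwise disjoint subsets of
`V`, which contains all `⟨∅, B | C⟩` and all `⟨A, ∅ | C⟩`. -/
@[ext]
structure IndependenceModel (V : Type*) where
  Indep : Set V → Set V → Set V → Prop
  disjoint : ∀ A B C, Indep A B C → Disjoint A B ∧ Disjoint A C ∧ Disjoint B C
  empty_left : ∀ B C, Disjoint B C → Indep ∅ B C
  empty_right : ∀ A C, Disjoint A C → Indep A ∅ C

/-- A list of nodes without repetition whose consecutive nodes are adjacent. -/
def IsNodePath {V : Type*} (S : SimpleGraph V) (p : List V) : Prop :=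
  p.Nodup ∧ p.IsChain S.Adj

/-- A directed ancestral graph: a simple graph with arrows (`arrow i j` is `i → j`) and arcs
(`arc i j` is `i ↔ j`), without a directed cycle and without an arc one endpoint of which is an
ancestor of the other. The last two conditions also forbid loops of arrows, two opposite arrows,
and an arrow and an arc between the same two nodes. -/
structure AncestralGraph (V : Type*) where
  arrow : V → V → Prop
  arc : V → V → Prop
  arc_symm : ∀ i j, arc i j → arc j i
  arc_irrefl : ∀ i, ¬ arc i i
  acyclic : ∀ i, ¬ Relation.TransGen arrow i i
  ancestral : ∀ i j, arc i j → ¬ Relation.TransGen arrow i j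

namespace AncestralGraph

variable {V : Type*} (G : AncestralGraph V)

/-- The set `an(i)` of ancestors of `i`; `i` itself is not one of them. -/
def an (i : V) : Set V := {k | Relation.TransGen G.arrow k i}

/-- `an(i, j) = (an(i) ∪ an(j)) \ {i, j}`. -/
def jointAn (i j : V) : Set V := (G.an i ∪ G.an j) \ {i, j}

/-- The skeleton `sk(G)`. -/
def skeleton : SimpleGraph V where
  Adj i j := G.arrow i j ∨ G.arrow j i ∨ G.arc i j
  symm := ⟨fun _ _ h => by
    rcases h with h | h | h
    · exact Or.inr (Or.inl h)
    · exact Or.inl h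
    · exact Or.inr (Or.inr (G.arc_symm _ _ h))⟩
  loopless := ⟨fun i h => by
    rcases h with h | h | h
    · exact G.acyclic i (.single h)
    · exact G.acyclic i (.single h)
    · exact G.arc_irrefl i h⟩

/-- A directed acyclic graph is a directed ancestral graph that has only arrows. -/
def IsDAG : Prop := ∀ i j, ¬ G.arc i j

/-- The minimal order of `G`: `i < k` if and only if `k` is an ancestor of `i`; in particular
`i → j` gives `i > j`, and nodes neither of which is an ancestor of the other are incomparable. -/
@[reducible]
def minimalOrder : PartialOrder V where
  le i k := Relation.ReflTransGen G.arrow k i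
  lt i k := k ∈ G.an i
  le_refl _ := .refl
  le_trans _ _ _ h h' := h'.trans h
  lt_iff_le_not_ge i k := by
    constructor
    · intro h
      exact ⟨Relation.TransGen.to_reflTransGen h,
        fun h' => G.acyclic k (Relation.TransGen.trans_left h h')⟩
    · rintro ⟨h, h'⟩
      rcases Relation.reflTransGen_iff_eq_or_transGen.1 h with rfl | h
      · exact absurd .refl h'
      · exact h
  le_antisymm i k h h' := by
    rcases Relation.reflTransGen_iff_eq_or_transGen.1 h with e | h
    · exact e
    · exact absurd (Relation.TransGen.trans_left h h') (G.acyclic k)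

/-- The `ut`-edge has an arrowhead at `t`. -/
def HeadAt (u t : V) : Prop := G.arrow u t ∨ G.arc u t

/-- The inner node `t` of the tripath `⟨u, t, w⟩` is a collider. -/
def IsCollider (u t w : V) : Prop := G.HeadAt u t ∧ G.HeadAt w t

/-- The path `p` is connecting given `C`: its collider nodes are in `C` or ancestors of nodes of
`C`, and its other inner nodes are not in `C`. -/
def IsConnecting (C : Set V) (p : List V) : Prop :=
  IsNodePath G.skeleton p ∧
    ∀ u t w, [u, t, w] <:+: p →
      (G.IsCollider u t w → t ∈ C ∨ ∃ c ∈ C, t ∈ G.an c) ∧ (¬ G.IsCollider u t w → t ∉ C)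

/-- The independence model `J(G)` that is induced by `m`-separation. -/
def indepModel : IndependenceModel V where
  Indep A B C := (Disjoint A B ∧ Disjoint A C ∧ Disjoint B C) ∧
    ∀ a ∈ A, ∀ b ∈ B, ¬ ∃ p : List V,
      p.head? = some a ∧ p.getLast? = some b ∧ G.IsConnecting C p
  disjoint _ _ _ h := h.1
  empty_left _ _ h := by simp [h]
  empty_right _ _ h := by simp [h]

/-- `G` is maximal: any two distinct non-adjacent nodes are separated given some set. -/
def IsMaximal : Prop :=
  ∀ i j, i ≠ j → ¬ G.skeleton.Adj i j → ∃ C, G.indepModel.Indep {i} {j} C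

/-- `G` and `H` are Markov equivalent. -/
def MarkovEquivalent (H : AncestralGraph V) : Prop := G.indepModel = H.indepModel

end AncestralGraph

namespace IndependenceModel

variable {V : Type*} (J : IndependenceModel V)

/-- The skeleton `sk(J)`: two distinct nodes are adjacent unless they are independent given some
set that contains neither of them. -/
def skeleton : SimpleGraph V where
  Adj i j := i ≠ j ∧ ¬ ∃ C : Set V, i ∉ C ∧ j ∉ C ∧ (J.Indep {i} {j} C ∨ J.Indep {j} {i} C)
  symm := ⟨fun _ _ h => ⟨h.1.symm, fun ⟨C, h1, h2, h3⟩ => h.2 ⟨C, h2, h1, h3.symm⟩⟩⟩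
  loopless := ⟨fun _ h => h.1 rfl⟩

/-- Ordered upward-stability with respect to the order `o`. -/
def OrderedUpwardStable (o : PartialOrder V) : Prop :=
  ∀ (i j : V) (C : Set V), J.Indep {i} {j} C →
    ∀ k, k ≠ i → k ≠ j → (o.lt i k ∨ o.lt j k) → J.Indep {i} {j} (C ∪ {k})

/-- Ordered downward-stability with respect to the order `o`. -/
def OrderedDownwardStable (o : PartialOrder V) : Prop :=
  ∀ (i j : V) (C : Set V), J.Indep {i} {j} C →
    ∀ k, k ≠ i → k ≠ j → ¬ o.lt i k → ¬ o.lt j k → (∀ l ∈ C \ {k}, ¬ o.lt l k) →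
      J.Indep {i} {j} (C \ {k})

/-- Ordered upward- and downward-stability with respect to `G`, that is, with respect to the
minimal order of `G`. -/
def OrderedStable (G : AncestralGraph V) : Prop :=
  J.OrderedUpwardStable G.minimalOrder ∧ J.OrderedDownwardStable G.minimalOrder

/-- `J` is Markovian to `G`: it satisfies the global Markov property, `J(G) ⊆ J`. -/
def Markovian (G : AncestralGraph V) : Prop :=
  ∀ A B C, G.indepModel.Indep A B C → J.Indep A B C

/-- `J` is converse pairwise Markovian to `G`. -/
def ConversePairwiseMarkovian (G : AncestralGraph V) : Prop :=
  ∀ i j, J.Indep {i} {j} (G.jointAn i j) → ¬ G.skeleton.Adj i j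

/-- `J` is path-unstable: `sk(J)` has a path `⟨i, i₁, …, iᵣ, k, j⟩` (`r ≥ 0`, and `u` is the list
of `i₁, …, iᵣ`) such that `i` is not adjacent to `j` and all of `i₁, …, iᵣ` are adjacent to `j`,
and `i` is independent of `j` given `U ∪ C` and given `U ∪ C ∪ {k}`, for some `C` disjoint from
`{i, j, k}`, where `U` is the set of `i₁, …, iᵣ`. -/
def PathUnstable : Prop :=
  ∃ (i k j : V) (u : List V), IsNodePath J.skeleton (i :: (u ++ [k, j])) ∧
    ¬ J.skeleton.Adj i j ∧ (∀ v ∈ u, J.skeleton.Adj v j) ∧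
    ∃ C : Set V, Disjoint C {i, j, k} ∧
      J.Indep {i} {j} ({v | v ∈ u} ∪ C) ∧ J.Indep {i} {j} ({v | v ∈ u} ∪ C ∪ {k})

def PathStable : Prop := ¬ J.PathUnstable

/-- `J` is V-unstable: `sk(J)` has a V-configuration `⟨i, k, j⟩` such that `i` is independent of
`j` given `C` and given `C ∪ {k}`, for some `C` disjoint from `{i, j, k}`. -/
def VUnstable : Prop :=
  ∃ i k j : V, IsNodePath J.skeleton [i, k, j] ∧ ¬ J.skeleton.Adj i j ∧
    ∃ C : Set V, Disjoint C {i, j, k} ∧ J.Indep {i} {j} C ∧ J.Indep {i} {j} (C ∪ {k})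

def VStable : Prop := ¬ J.VUnstable

/-- `G` is a possible output, on input `J`, of a natural structure-learning algorithm. -/
def IsNaturalOutput (G : AncestralGraph V) : Prop :=
  G.skeleton = J.skeleton ∧ J.OrderedStable G

end IndependenceModel

section Probability

variable {V : Type*} {X : V → Type*} [∀ v, MeasurableSpace (X v)]

/-- The subvector `x_A = (x_v)_{v ∈ A}` of `x`. -/
def coords (X : V → Type*) (A : Set V) (x : ∀ v, X v) : ∀ v : A, X v := fun v => x v

/-- The `σ`-algebra on the joint state space that is generated by `X_A = (X_v)_{v ∈ A}`. -/
@[reducible]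
def sigmaOf (X : V → Type*) [∀ v, MeasurableSpace (X v)] (A : Set V) :
    MeasurableSpace (∀ v, X v) :=
  MeasurableSpace.comap (coords X A) MeasurableSpace.pi

/-- `X_A` is conditionally independent of `X_B` given `X_C` under the joint distribution `P`: for
every measurable `S`, almost surely `ℙ(X_A ∈ S | X_B, X_C) = ℙ(X_A ∈ S | X_C)`. -/
def CondIndepCoords (P : Measure (∀ v, X v)) (A B C : Set V) : Prop :=
  ∀ S : Set (∀ v : A, X v), MeasurableSet S →
    P[(coords X A ⁻¹' S).indicator (fun _ => (1 : ℝ)) | sigmaOf X (B ∪ C)] =ᵐ[P]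
      P[(coords X A ⁻¹' S).indicator (fun _ => (1 : ℝ)) | sigmaOf X C]

theorem sigmaOf_le (A : Set V) : sigmaOf X A ≤ MeasurableSpace.pi := by
  have h : Measurable (coords X A) := measurable_pi_lambda _ fun v => measurable_pi_apply (v : V)
  exact h.comap_le

/-- The independence model `J(P)` of a joint probability distribution `P`. -/
def probIndepModel (P : Measure (∀ v, X v)) [IsProbabilityMeasure P] : IndependenceModel V where
  Indep A B C := (Disjoint A B ∧ Disjoint A C ∧ Disjoint B C) ∧ CondIndepCoords P A B C
  disjoint _ _ _ h := h.1
  empty_left B C h := by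
    refine ⟨by simp [h], fun S _ => ?_⟩
    have key : ∃ c : ℝ, (coords X ∅ ⁻¹' S).indicator (fun _ => (1 : ℝ)) = fun _ => c := by
      by_cases h0 : (fun v => (Set.notMem_empty _ v.2).elim) ∈ S
      · refine ⟨1, funext fun x => Set.indicator_of_mem (Set.mem_preimage.2 ?_) _⟩
        convert h0 using 1
        exact Subsingleton.elim _ _
      · refine ⟨0, funext fun x => Set.indicator_of_notMem (fun hx => h0 ?_) _⟩
        convert Set.mem_preimage.1 hx using 1
        exact Subsingleton.elim _ _
    obtain ⟨c, hc⟩ := key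
    rw [hc, condExp_const (sigmaOf_le _), condExp_const (sigmaOf_le _)]
  empty_right A C h := by
    refine ⟨by simp [h], fun S _ => ?_⟩
    rw [Set.empty_union]

end Probability

/-! The proof joins a probabilistic argument to a combinatorial one. Ordered upward- and
downward-stability turn any independence of `i` and `j` into independence given `an(i, j)`
(`OrderedStable.indep_jointAn`). With the Markov hypotheses and maximality of `G₀`, this gives
`sk(G₀) = sk(P)`, so `G₀` and the output `G` have the same skeleton, and `P` is ordered stable with
respect to both.

Suppose a path from `i` discriminates the triple at `k` towards `j` in both graphs, and `k` is a
collider of that triple in one graph only, say `G`. Then `k` is an ancestor of `i` or `j` in `H`,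
but not in `G`, where the path would otherwise be inducing. Starting from independence given the
joint ancestors in `G`, one may add the joint ancestors in `H` with or without `k`: exactly what
path-stability forbids (`exists_indep_of_isCollider`). For DAGs discriminating paths reduce to
V-configurations, and V-stability suffices. Hence the graphs agree on discriminated triples
(`SameDiscriminated`).

Such agreement, a common skeleton and absence of nonadjacent inducing paths imply Markov
equivalence. Among the shortest open walks of one graph between given endpoints, take one whose
colliders are nearest to `C` in total. Each of its triples is unshielded or discriminated from one
side, which makes the collider statuses agree (`isCollider_iff_of_isShortestWalk`). A shortest
directed path from a collider to `C` also survives in the other graph: its first arrow by a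
discriminating path, the later ones by unshielded triples (`SameDiscriminated.exists_isOpenWalk`).
-/

namespace AncestralGraph

variable {V : Type*} {G H : AncestralGraph V} {C : Set V}

/-! ### Arrowheads and ancestors -/

theorem HeadAt.adj {u t : V} (h : G.HeadAt u t) : G.skeleton.Adj u t := by
  rcases h with h | h
  · exact Or.inl h
  · exact Or.inr (Or.inr h)

/-- A node with an arrowhead at it is not an ancestor of the other endpoint. -/
theorem HeadAt.not_transGen {u t : V} (h : G.HeadAt u t) : ¬ Relation.TransGen G.arrow t u := by
  intro h'
  rcases h with h | h
  · exact G.acyclic t (h'.tail h)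
  · exact G.ancestral t u (G.arc_symm _ _ h) h'

theorem HeadAt.not_arrow {u t : V} (h : G.HeadAt u t) : ¬ G.arrow t u :=
  fun h' => h.not_transGen (.single h')

theorem headAt_of_not_arrow {u t : V} (h : G.skeleton.Adj u t) (h' : ¬ G.arrow t u) :
    G.HeadAt u t := by
  rcases h with h | h | h
  · exact Or.inl h
  · exact absurd h h'
  · exact Or.inr h

theorem arrow_of_not_headAt {u t : V} (h : G.skeleton.Adj u t) (h' : ¬ G.HeadAt u t) :
    G.arrow t u := by
  by_contra hc
  exact h' (headAt_of_not_arrow h hc)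

/-- If `u *→ t` and `t` is an ancestor of `w`, then an edge between `u` and `w` has an arrowhead
at `w`. -/
theorem HeadAt.trans_adj {u t w : V} (h : G.HeadAt u t) (h' : G.arrow t w)
    (hadj : G.skeleton.Adj u w) : G.HeadAt u w :=
  headAt_of_not_arrow hadj fun hc => h.not_transGen ((Relation.TransGen.single h').tail hc)

theorem isCollider_comm {u t w : V} : G.IsCollider u t w ↔ G.IsCollider w t u :=
  ⟨fun h => ⟨h.2, h.1⟩, fun h => ⟨h.2, h.1⟩⟩

variable (G C) in
/-- `t` is in `C` or an ancestor of a node of `C`. -/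
def InAn (t : V) : Prop := t ∈ C ∨ ∃ c ∈ C, t ∈ G.an c

theorem InAn.of_arrow {t w : V} (h : G.arrow t w) (hw : G.InAn C w) : G.InAn C t := by
  rcases hw with hw | ⟨c, hc, hw⟩
  · exact Or.inr ⟨w, hw, .single h⟩
  · exact Or.inr ⟨c, hc, Relation.TransGen.head h hw⟩

theorem InAn.of_transGen {t w : V} (h : Relation.TransGen G.arrow t w) (hw : G.InAn C w) :
    G.InAn C t := by
  induction h using Relation.TransGen.head_induction_on with
  | single h => exact hw.of_arrow h
  | head h _ ih => exact ih.of_arrow h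

variable (G C) in
/-- The inner node `t` of the tripath `⟨u, t, w⟩` does not block given `C`. -/
def OpenAt (u t w : V) : Prop :=
  (G.IsCollider u t w → G.InAn C t) ∧ (¬ G.IsCollider u t w → t ∉ C)

theorem openAt_comm {u t w : V} : G.OpenAt C u t w ↔ G.OpenAt C w t u := by
  simp only [OpenAt, isCollider_comm (u := u)]

theorem OpenAt.congr {u t w u' w' : V} (h : G.OpenAt C u t w)
    (e : G.IsCollider u' t w' ↔ G.IsCollider u t w) : G.OpenAt C u' t w' := by
  simpa only [OpenAt, e] using h

/-! ### Open walks and shortest open walks -/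

variable (G C) in
/-- The nodes `v 0, …, v n` form a walk, none of whose inner nodes blocks given `C`. -/
structure IsOpenWalk (v : ℕ → V) (n : ℕ) : Prop where
  adj : ∀ k < n, G.skeleton.Adj (v k) (v (k + 1))
  openAt : ∀ k, k + 2 ≤ n → G.OpenAt C (v k) (v (k + 1)) (v (k + 2))

namespace IsOpenWalk

variable {v : ℕ → V} {n : ℕ}

theorem reverse (h : G.IsOpenWalk C v n) : G.IsOpenWalk C (fun k => v (n - k)) n where
  adj k hk := by
    have := h.adj (n - (k + 1)) (by omega)
    rw [show n - (k + 1) + 1 = n - k by omega] at this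
    exact this.symm
  openAt k hk := by
    have := h.openAt (n - (k + 2)) (by omega)
    rw [show n - (k + 2) + 1 = n - (k + 1) by omega,
      show n - (k + 2) + 2 = n - k by omega] at this
    exact openAt_comm.1 this

theorem take (h : G.IsOpenWalk C v n) {m : ℕ} (hm : m ≤ n) : G.IsOpenWalk C v m where
  adj k hk := h.adj k (by omega)
  openAt k hk := h.openAt k (by omega)

/-- Removing the nodes strictly between the `l`-th and the `r`-th. -/
theorem skip (h : G.IsOpenWalk C v n) {l r : ℕ} (hlr : l < r) (hr : r ≤ n)
    (hadj : G.skeleton.Adj (v l) (v r))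
    (hl : ∀ k, k + 1 = l → G.OpenAt C (v k) (v l) (v r))
    (hr' : r + 1 ≤ n → G.OpenAt C (v l) (v r) (v (r + 1))) :
    G.IsOpenWalk C (fun k => if k ≤ l then v k else v (k + (r - l - 1))) (n - (r - l - 1)) where
  adj k hk := by
    rcases lt_trichotomy k l with hkl | rfl | hkl
    · simp only [hkl.le, if_true, show k + 1 ≤ l by omega]
      exact h.adj k (by omega)
    · simpa [show k + 1 + (r - k - 1) = r by omega] using hadj
    · simp only [show ¬ k ≤ l by omega, if_false, show ¬ k + 1 ≤ l by omega]
      have := h.adj (k + (r - l - 1)) (by omega)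
      rwa [show k + (r - l - 1) + 1 = k + 1 + (r - l - 1) by omega] at this
  openAt k hk := by
    rcases lt_trichotomy (k + 1) l with hkl | hkl | hkl
    · simp only [show k ≤ l by omega, if_true, show k + 1 ≤ l by omega, show k + 2 ≤ l by omega]
      exact h.openAt k (by omega)
    · subst hkl
      simpa [show k + 2 + (r - (k + 1) - 1) = r by omega] using hl k rfl
    · rcases Nat.lt_succ_iff_lt_or_eq.1 hkl with hkl | rfl
      · simp only [show ¬ k ≤ l by omega, if_false, show ¬ k + 1 ≤ l by omega,
          show ¬ k + 2 ≤ l by omega]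
        have := h.openAt (k + (r - l - 1)) (by omega)
        rwa [show k + (r - l - 1) + 1 = k + 1 + (r - l - 1) by omega,
          show k + (r - l - 1) + 2 = k + 2 + (r - l - 1) by omega] at this
      · simpa [show l + 1 + (r - l - 1) = r by omega, show l + 2 + (r - l - 1) = r + 1 by omega]
          using hr' (by omega)

/-- Following an arrow along an open walk, one meets an ancestor of `C` or arrows only. -/
theorem arrow_run (h : G.IsOpenWalk C v n) {k : ℕ} (hk : G.arrow (v k) (v (k + 1))) (j : ℕ)
    (hj : k + j + 1 ≤ n) :
    G.InAn C (v k) ∨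
      (Relation.TransGen G.arrow (v k) (v (k + j + 1)) ∧
        G.arrow (v (k + j)) (v (k + j + 1))) := by
  induction j with
  | zero => exact Or.inr ⟨.single hk, hk⟩
  | succ j ih =>
    rcases ih (by omega) with ih | ⟨ih, ih'⟩
    · exact Or.inl ih
    · by_cases hh : G.HeadAt (v (k + j + 2)) (v (k + j + 1))
      · exact Or.inl (((h.openAt (k + j) (by omega)).1 ⟨Or.inl ih', hh⟩).of_transGen ih)
      · have := arrow_of_not_headAt (h.adj (k + j + 1) (by omega)).symm hh
        exact Or.inr ⟨ih.tail this, this⟩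

theorem inAn_or_transGen_last (h : G.IsOpenWalk C v n) {k : ℕ}
    (hk : G.arrow (v k) (v (k + 1))) {j : ℕ} (hj : k < j) (hjn : j ≤ n) :
    G.InAn C (v k) ∨ Relation.TransGen G.arrow (v k) (v j) := by
  have := h.arrow_run hk (j - k - 1) (by omega)
  rw [show k + (j - k - 1) + 1 = j by omega] at this
  exact this.imp_right And.left

/-- A shortest open walk has no repeated nodes. -/
theorem injOn_of_minimal (h : G.IsOpenWalk C v n)
    (hmin : ∀ w m, G.IsOpenWalk C w m → w 0 = v 0 → w m = v n → n ≤ m)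
    {i j : ℕ} (hij : i < j) (hj : j ≤ n) : v i ≠ v j := by
  intro e
  rcases Nat.lt_or_ge j n with hjn | hjn
  · have hw := h.skip (l := i) (r := j + 1) (by omega) (by omega)
      (by rw [e]; exact h.adj j hjn) ?_ ?_
    · have := hmin _ _ hw (by simp) ?_
      · omega
      · simp only [show ¬ n - (j + 1 - i - 1) ≤ i by omega, if_false]
        congr 1; omega
    · rintro k rfl
      have h1 := h.openAt k (by omega)
      have h2 := h.openAt (j - 1) (by omega)
      rw [show j - 1 + 1 = j by omega, show j - 1 + 2 = j + 1 by omega] at h2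
      constructor
      · intro hc
        by_cases c1 : G.IsCollider (v k) (v (k + 1)) (v (k + 2))
        · exact h1.1 c1
        · have ha : G.arrow (v (k + 1)) (v (k + 2)) :=
            arrow_of_not_headAt (h.adj (k + 1) (by omega)).symm fun hh => c1 ⟨hc.1, hh⟩
          rcases h.inAn_or_transGen_last ha hij hj with h3 | h3
          · exact h3
          · rw [← e] at h3
            exact absurd h3 (G.acyclic _)
      · intro hc
        by_cases c1 : G.HeadAt (v k) (v (k + 1))
        · rw [e]
          refine h2.2 fun hc2 => hc ⟨c1, ?_⟩
          rw [e]; exact hc2.2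
        · exact h1.2 fun hc1 => c1 hc1.1
    · intro hjn'
      rw [e]
      exact h.openAt j (by omega)
  · have := hmin v i (h.take (by omega)) rfl (by rw [e]; congr 1; omega)
    omega

end IsOpenWalk

theorem exists_minimal_isOpenWalk {v : ℕ → V} {n : ℕ} (h : G.IsOpenWalk C v n) :
    ∃ w m, G.IsOpenWalk C w m ∧ w 0 = v 0 ∧ w m = v n ∧
      ∀ w' m', G.IsOpenWalk C w' m' → w' 0 = w 0 → w' m' = w m → m ≤ m' := by
  classical
  have hex : ∃ m, ∃ w, G.IsOpenWalk C w m ∧ w 0 = v 0 ∧ w m = v n := ⟨n, v, h, rfl, rfl⟩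
  obtain ⟨w, hw, h0, h1⟩ := Nat.find_spec hex
  refine ⟨w, _, hw, h0, h1, fun w' m' hw' h0' h1' => Nat.find_min' hex ⟨w', hw', ?_, ?_⟩⟩
  · rw [h0', h0]
  · rw [h1', h1]

/-! ### Connecting paths as open walks -/

theorem infix_triple_iff {p : List V} {u t w : V} :
    [u, t, w] <:+: p ↔ ∃ k, p[k]? = some u ∧ p[k + 1]? = some t ∧ p[k + 2]? = some w := by
  rw [List.infix_iff_getElem?]
  constructor
  · rintro ⟨k, hk, h⟩
    exact ⟨k, by simpa using h 0 (by simp), by simpa [add_comm] using h 1 (by simp),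
      by simpa [add_comm] using h 2 (by simp)⟩
  · rintro ⟨k, h0, h1, h2⟩
    have := (List.getElem?_eq_some_iff.1 h2).1
    refine ⟨k, by simpa using by omega, fun i hi => ?_⟩
    simp only [List.length_cons, List.length_nil] at hi
    interval_cases i
    · simpa using h0
    · simpa [add_comm] using h1
    · simpa [add_comm] using h2

/-- Connecting paths correspond to open walks without repetition. -/
theorem exists_isOpenWalk_of_isConnecting {p : List V} {a b : V} (h0 : p.head? = some a)
    (h1 : p.getLast? = some b) (h : G.IsConnecting C p) :
    ∃ v n, G.IsOpenWalk C v n ∧ v 0 = a ∧ v n = b := by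
  have hp : p ≠ [] := by rintro rfl; simp at h0
  have hlen : 0 < p.length := List.length_pos_iff.2 hp
  have key : ∀ k < p.length, p[k]? = some (p[k]?.getD a) := by
    intro k hk
    simp [hk]
  -- The default `a` is never read at an index up to `p.length - 1`.
  refine ⟨fun k => p[k]?.getD a, p.length - 1, ⟨?_, ?_⟩, ?_, ?_⟩
  · intro k hk
    have := List.isChain_iff_getElem.1 h.1.2 k (by omega)
    simpa [show k < p.length by omega, show k + 1 < p.length by omega] using this
  · intro k hk
    exact h.2 _ _ _ (infix_triple_iff.2 ⟨k, key _ (by omega), key _ (by omega), key _ (by omega)⟩)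
  · simp only
    rw [List.head?_eq_getElem?] at h0
    simp [h0]
  · simp only
    rw [List.getLast?_eq_getElem?] at h1
    simp [h1]

theorem IsOpenWalk.exists_isConnecting_of_injOn {v : ℕ → V} {n : ℕ} (h : G.IsOpenWalk C v n)
    (hinj : ∀ i j, i < j → j ≤ n → v i ≠ v j) :
    ∃ p : List V, p.head? = some (v 0) ∧ p.getLast? = some (v n) ∧ G.IsConnecting C p := by
  refine ⟨(List.range (n + 1)).map v, ?_, ?_, ⟨?_, ?_⟩, ?_⟩
  · simp [List.head?_eq_getElem?]
  · simp [List.getLast?_eq_getElem?]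
  · refine List.Nodup.map_on ?_ List.nodup_range
    intro x hx y hy e
    simp only [List.mem_range] at hx hy
    rcases lt_trichotomy x y with hxy | hxy | hxy
    · exact absurd e (hinj x y hxy (by omega))
    · exact hxy
    · exact absurd e.symm (hinj y x hxy (by omega))
  · rw [List.isChain_iff_getElem]
    intro k hk
    simp only [List.length_map, List.length_range] at hk
    simpa using h.adj k (by omega)
  · intro u t w hinf
    obtain ⟨k, hu, ht, hw⟩ := infix_triple_iff.1 hinf
    have hk := (List.getElem?_eq_some_iff.1 hw).1
    simp only [List.length_map, List.length_range] at hk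
    rw [List.getElem?_map, List.getElem?_range (by omega)] at hu ht hw
    simp only [Option.map_some, Option.some.injEq] at hu ht hw
    subst hu ht hw
    exact h.openAt k (by omega)

/-- Repetitions are harmless, because a shortest open walk with the same endpoints has none.
Constructions may therefore glue walks freely. -/
theorem IsOpenWalk.exists_isConnecting {v : ℕ → V} {n : ℕ} (h : G.IsOpenWalk C v n) :
    ∃ p : List V, p.head? = some (v 0) ∧ p.getLast? = some (v n) ∧ G.IsConnecting C p := by
  obtain ⟨w, m, hw, h0, h1, hmin⟩ := exists_minimal_isOpenWalk h
  rw [← h0, ← h1]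
  exact hw.exists_isConnecting_of_injOn fun i j => hw.injOn_of_minimal hmin

/-- Attaching a node `x` in front of an open walk whose first node `v 0 ∉ C` has an arrow
`v 0 → x`. -/
theorem IsOpenWalk.cons {v : ℕ → V} {n : ℕ} (h : G.IsOpenWalk C v n) {x : V}
    (hx : G.arrow (v 0) x) (h0 : v 0 ∉ C) :
    G.IsOpenWalk C (fun k => Nat.casesOn k x v) (n + 1) where
  adj k hk := by
    cases k with
    | zero => exact Or.inr (Or.inl hx)
    | succ k => exact h.adj k (by omega)
  openAt k hk := by
    cases k with
    | zero => exact ⟨fun hc => absurd hx hc.1.not_arrow, fun _ => h0⟩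
    | succ k => exact h.openAt k (by omega)

/-- The directed path from `v 0` to `x` is prepended backwards. It avoids `C`, except possibly at
`x`, since `v 0` has no descendant in `C`, and each node that becomes inner has an outgoing arrow,
hence is an open non-collider. -/
theorem IsOpenWalk.exists_of_transGen {v : ℕ → V} {n : ℕ} (h : G.IsOpenWalk C v n) {x : V}
    (hx : Relation.TransGen G.arrow (v 0) x) (h0 : ¬ G.InAn C (v 0)) :
    ∃ w m, G.IsOpenWalk C w m ∧ w 0 = x ∧ w m = v n := by
  generalize hy : v 0 = y at hx h0
  induction hx using Relation.TransGen.head_induction_on generalizing v n with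
  | single hy' =>
    subst hy
    exact ⟨_, _, h.cons hy' fun hC => h0 (Or.inl hC), rfl, rfl⟩
  | head hy' _ ih =>
    subst hy
    have hw := h.cons hy' fun hC => h0 (Or.inl hC)
    have := ih hw rfl fun hC => h0 (hC.of_arrow hy')
    exact this

/-! ### Inducing walks and maximality -/

variable (G) in
/-- The endpoints of every inducing walk are adjacent. -/
def InducingClosed : Prop :=
  ∀ (v : ℕ → V) (n : ℕ), v 0 ≠ v n → (∀ k < n, G.skeleton.Adj (v k) (v (k + 1))) →
    (∀ k, k + 2 ≤ n → G.IsCollider (v k) (v (k + 1)) (v (k + 2)) ∧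
      v (k + 1) ∈ G.an (v 0) ∪ G.an (v n)) → G.skeleton.Adj (v 0) (v n)

/-- An inducing walk defeats every candidate separator `C`. Colliders that are not ancestors of `C`
have directed paths to an endpoint that avoid `C`; such detours, joined by a stretch of open
colliders, form an open walk. -/
theorem IsMaximal.inducingClosed (hG : G.IsMaximal) : G.InducingClosed := by
  classical
  intro v n hne hadj hcol
  by_contra hnadj
  obtain ⟨C, ⟨-, hC0, hCn⟩, hC⟩ := hG _ _ hne hnadj
  suffices h : ∃ w m, G.IsOpenWalk C w m ∧ w 0 = v 0 ∧ w m = v n by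
    obtain ⟨w, m, hw, h0, hm⟩ := h
    obtain ⟨p, hp⟩ := hw.exists_isConnecting
    rw [h0, hm] at hp
    exact hC _ rfl _ rfl ⟨p, hp⟩
  have hn : 0 < n := Nat.pos_of_ne_zero fun h => hne (by rw [h])
  -- the last node from which `v 0` can be reached outside `C`
  let A : ℕ → Prop := fun k => k < n ∧ (k = 0 ∨ ¬ G.InAn C (v k) ∧ v k ∈ G.an (v 0))
  obtain ⟨m, hm, hmax⟩ : ∃ m, A m ∧ ∀ k, m < k → ¬ A k := by
    have hA : ∃ m, m ≤ n ∧ A m := ⟨0, by omega, hn, Or.inl rfl⟩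
    obtain ⟨m0, hm0, hA0⟩ := hA
    refine ⟨Nat.findGreatest A n, Nat.findGreatest_spec hm0 hA0, fun k hk hAk => ?_⟩
    exact Nat.findGreatest_is_greatest hk hAk.1.le hAk
  -- the next node from which `v n` can be reached outside `C`
  let B : ℕ → Prop := fun k => m < k ∧ k ≤ n ∧ (k = n ∨ ¬ G.InAn C (v k) ∧ v k ∈ G.an (v n))
  have hB : ∃ r, B r := ⟨n, hm.1, le_rfl, Or.inl rfl⟩
  obtain ⟨hmr, hrn, hr⟩ := Nat.find_spec hB
  have hmin : ∀ k < Nat.find hB, ¬ B k := fun k hk => Nat.find_min hB hk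
  generalize Nat.find hB = r at hmr hrn hr hmin
  have hseg : G.IsOpenWalk C (fun k => v (m + k)) (r - m) := by
    refine ⟨fun k hk => hadj (m + k) (by omega), fun k hk => ?_⟩
    have h1 := hcol (m + k) (by omega)
    refine ⟨fun _ => ?_, fun hc => absurd h1.1 hc⟩
    by_contra hI
    rcases h1.2 with h2 | h2
    · exact hmax (m + k + 1) (by omega) ⟨by omega, Or.inr ⟨hI, h2⟩⟩
    · exact hmin (m + k + 1) (by omega) ⟨by omega, by omega, Or.inr ⟨hI, h2⟩⟩
  have hleft : ∃ w l, G.IsOpenWalk C w l ∧ w 0 = v 0 ∧ w l = v r := by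
    have e : v (m + (r - m)) = v r := by congr 1; omega
    rcases hm.2 with h0 | ⟨hI, h0⟩
    · refine ⟨_, _, hseg, by simp [h0], e⟩
    · obtain ⟨w, l, hw, hw0, hwl⟩ := hseg.exists_of_transGen (x := v 0) h0 hI
      exact ⟨w, l, hw, hw0, hwl.trans e⟩
  obtain ⟨w, l, hw, hw0, hwl⟩ := hleft
  rcases hr with rfl | ⟨hI, hr⟩
  · exact ⟨w, l, hw, hw0, hwl⟩
  · obtain ⟨w', l', hw', hw0', hwl'⟩ := hw.reverse.exists_of_transGen (x := v n)
      (by simpa [hwl] using (show Relation.TransGen G.arrow (v r) (v n) from hr)) (by simpa [hwl] using hI)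
    refine ⟨_, _, hw'.reverse, ?_, ?_⟩
    · simp [hwl', hw0]
    · simp [hw0']

/-- Without arcs two consecutive inner nodes cannot both be colliders, and a single collider cannot
be an ancestor of one of its neighbours. So an inducing walk is one edge. -/
theorem IsDAG.inducingClosed (hG : G.IsDAG) : G.InducingClosed := by
  have harrow : ∀ {u t}, G.HeadAt u t → G.arrow u t := fun h => h.resolve_right (hG _ _)
  intro v n hne hadj hcol
  match n with
  | 0 => exact absurd rfl hne
  | 1 => exact hadj 0 (by omega)
  | 2 =>
    obtain ⟨⟨h0, h2⟩, h | h⟩ := hcol 0 le_rfl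
    · exact absurd h h0.not_transGen
    · exact absurd h h2.not_transGen
  | n + 3 =>
    exact absurd (harrow (hcol 0 (by omega)).1.2) (hcol 1 (by omega)).1.1.not_arrow

/-- Nodes of an open walk that are not ancestors of `C` are ancestors of an endpoint. -/
theorem IsOpenWalk.mem_an {v : ℕ → V} {n : ℕ} (h : G.IsOpenWalk C v n) {k : ℕ}
    (hk : k + 2 ≤ n) : G.InAn C (v (k + 1)) ∨ v (k + 1) ∈ G.an (v 0) ∪ G.an (v n) := by
  by_cases hc : G.IsCollider (v k) (v (k + 1)) (v (k + 2))
  · exact Or.inl ((h.openAt k hk).1 hc)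
  · rcases not_and_or.1 hc with hc | hc
    · have ha := arrow_of_not_headAt (h.adj k (by omega)) hc
      have := h.reverse.inAn_or_transGen_last (k := n - (k + 1)) (j := n)
        (by rwa [show n - (n - (k + 1)) = k + 1 by omega,
          show n - (n - (k + 1) + 1) = k by omega]) (by omega) le_rfl
      simp only [show n - (n - (k + 1)) = k + 1 by omega, Nat.sub_self] at this
      exact this.imp_right Or.inl
    · have ha := arrow_of_not_headAt (h.adj (k + 1) (by omega)).symm hc
      exact (h.inAn_or_transGen_last (j := n) ha (by omega) le_rfl).imp_right Or.inr

/-- The joint ancestors separate: on a shortest walk that is open given `an(i, j)`, all inner nodes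
are ancestors of an endpoint, so a non-collider would lie in the conditioning set. The walk is thus
inducing. -/
theorem InducingClosed.isMaximal (hG : G.InducingClosed) : G.IsMaximal := by
  intro i j hne hnadj
  refine ⟨G.jointAn i j, ⟨by simpa using hne, by simp [jointAn], by simp [jointAn]⟩, ?_⟩
  rintro _ rfl _ rfl ⟨p, h0, h1, hp⟩
  obtain ⟨v, n, hv, e0, en⟩ := exists_isOpenWalk_of_isConnecting h0 h1 hp
  obtain ⟨w, m, hw, f0, fm, hmin⟩ := exists_minimal_isOpenWalk hv
  rw [e0] at f0
  rw [en] at fm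
  subst f0 fm
  refine hnadj (hG w m hne hw.adj fun k hk => ?_)
  have han : w (k + 1) ∈ G.an (w 0) ∪ G.an (w m) := by
    rcases hw.mem_an hk with h | h
    · rcases h with h | ⟨c, hc, h⟩
      · exact h.1
      · exact hc.1.imp (fun hc => h.trans hc) fun hc => h.trans hc
    · exact h
  refine ⟨?_, han⟩
  by_contra hc
  refine (hw.openAt k hk).2 hc ⟨han, ?_⟩
  rintro (h | h)
  · exact hw.injOn_of_minimal hmin (i := 0) (j := k + 1) (by omega) (by omega) h.symm
  · exact hw.injOn_of_minimal hmin (i := k + 1) (j := m) (by omega) le_rfl h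

/-! ### Discriminating paths on shortest walks -/

/-- Following a collider path backwards from a parent `v (k + 1)` of `y`, one finds either a
discriminating path for the triple that precedes `y`, or an edge `v l *→ y` that may replace
the edge `v l v (l + 1)`. -/
theorem exists_discriminating_or_shortcut {v : ℕ → V} {k : ℕ} {y : V}
    (hadj : ∀ s ≤ k, G.skeleton.Adj (v s) (v (s + 1)))
    (hhead : G.HeadAt (v k) (v (k + 1))) (harrow : G.arrow (v (k + 1)) y) :
    (∃ l ≤ k, v l ≠ y ∧ ¬ G.skeleton.Adj (v l) y ∧
      ∀ s, l ≤ s → s < k → G.IsCollider (v s) (v (s + 1)) (v (s + 2)) ∧ G.arrow (v (s + 1)) y) ∨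
    (∃ l ≤ k, G.HeadAt (v l) y ∧
      ∀ s, s + 1 = l → (G.IsCollider (v s) (v l) y ↔ G.IsCollider (v s) (v l) (v (l + 1)))) := by
  induction k with
  | zero =>
    by_cases ha : G.skeleton.Adj (v 0) y
    · exact Or.inr ⟨0, le_rfl, hhead.trans_adj harrow ha, by omega⟩
    · refine Or.inl ⟨0, le_rfl, ?_, ha, by omega⟩
      rintro rfl
      exact hhead.not_arrow harrow
  | succ k ih =>
    by_cases ha : G.skeleton.Adj (v (k + 1)) y
    swap
    · refine Or.inl ⟨k + 1, le_rfl, ?_, ha, by omega⟩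
      rintro rfl
      exact hhead.not_arrow harrow
    have hy := hhead.trans_adj harrow ha
    -- If redirecting `v (k + 1)` to `y` preserves its status, this is the shortcut. Otherwise
    -- ancestrality forces `v (k + 1)` to be a collider of the walk and a parent of `y`, so the
    -- discriminating path grows by one node.
    by_cases hc : G.IsCollider (v k) (v (k + 1)) y ↔ G.IsCollider (v k) (v (k + 1)) (v (k + 2))
    · refine Or.inr ⟨k + 1, le_rfl, hy, fun s hs => ?_⟩
      obtain rfl : s = k := by omega
      exact hc
    have h1 : G.HeadAt (v k) (v (k + 1)) := by
      by_contra h1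
      exact hc ⟨fun h => absurd h.1 h1, fun h => absurd h.1 h1⟩
    by_cases h2 : G.HeadAt y (v (k + 1))
    · by_cases h3 : G.HeadAt (v (k + 2)) (v (k + 1))
      · exact absurd ⟨fun _ => ⟨h1, h3⟩, fun _ => ⟨h1, h2⟩⟩ hc
      · have := arrow_of_not_headAt (hadj (k + 1) le_rfl).symm h3
        exact absurd ((Relation.TransGen.single this).tail harrow) h2.not_transGen
    · have h3 : G.HeadAt (v (k + 2)) (v (k + 1)) := by
        by_contra h3
        exact hc ⟨fun h => absurd h.2 h2, fun h => absurd h.2 h3⟩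
      have h4 := arrow_of_not_headAt ha.symm h2
      have hcol : G.IsCollider (v k) (v (k + 1)) (v (k + 2)) := ⟨h1, h3⟩
      rcases ih (fun s hs => hadj s (by omega)) h1 h4 with ⟨l, hl, h5, h6, h7⟩ | ⟨l, hl, h⟩
      · refine Or.inl ⟨l, by omega, h5, h6, fun s hs hsk => ?_⟩
        rcases Nat.lt_succ_iff_lt_or_eq.1 hsk with hsk | rfl
        · exact h7 s hs hsk
        · exact ⟨hcol, h4⟩
      · exact Or.inr ⟨l, by omega, h⟩

variable (G) in
/-- The triple of `v` at `m + 1` is unshielded, or discriminated by a path from the left. -/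
def DiscriminatedAt (v : ℕ → V) (m : ℕ) : Prop :=
  ∃ l ≤ m, ¬ G.skeleton.Adj (v l) (v (m + 2)) ∧
    ∀ s, l ≤ s → s < m →
      G.IsCollider (v s) (v (s + 1)) (v (s + 2)) ∧ G.arrow (v (s + 1)) (v (m + 2))

variable (G C) in
/-- An open walk that is shortest among those with the same endpoints. -/
structure IsShortestWalk (v : ℕ → V) (n : ℕ) : Prop extends G.IsOpenWalk C v n where
  le_of_isOpenWalk : ∀ w m, G.IsOpenWalk C w m → w 0 = v 0 → w m = v n → n ≤ m

namespace IsShortestWalk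

variable {v : ℕ → V} {n : ℕ}

theorem ne (h : G.IsShortestWalk C v n) {i j : ℕ} (hij : i ≠ j) (hi : i ≤ n) (hj : j ≤ n) :
    v i ≠ v j := by
  rcases Nat.lt_or_gt_of_ne hij with hij | hij
  · exact h.injOn_of_minimal h.le_of_isOpenWalk hij hj
  · exact (h.injOn_of_minimal h.le_of_isOpenWalk hij hi).symm

theorem reverse (h : G.IsShortestWalk C v n) : G.IsShortestWalk C (fun k => v (n - k)) n where
  toIsOpenWalk := h.toIsOpenWalk.reverse
  le_of_isOpenWalk w m hw h0 hm := by
    simp only [Nat.sub_zero, Nat.sub_self] at h0 hm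
    exact h.le_of_isOpenWalk _ m hw.reverse (by simpa using hm) (by simpa using h0)

theorem not_skip (h : G.IsShortestWalk C v n) {l r : ℕ} (hlr : l + 1 < r) (hr : r ≤ n)
    (hadj : G.skeleton.Adj (v l) (v r))
    (hl : ∀ k, k + 1 = l → G.OpenAt C (v k) (v l) (v r))
    (hr' : r + 1 ≤ n → G.OpenAt C (v l) (v r) (v (r + 1))) : False := by
  have hw := h.skip (by omega) hr hadj hl hr'
  have := h.le_of_isOpenWalk _ _ hw (by simp) ?_
  · omega
  · simp only [show ¬ n - (r - l - 1) ≤ l by omega, if_false]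
    congr 1; omega

/-- The alternative to a discriminating path is an edge `v l *→ v (k + 3)`. The old edge into `v (k
+ 3)` also has an arrowhead there, so the shortcut would preserve all statuses and shorten the walk.
-/
theorem discriminatedAt_of_arrow (h : G.IsShortestWalk C v n) {k : ℕ} (hk : k + 3 ≤ n)
    (h1 : G.HeadAt (v k) (v (k + 1))) (h2 : G.HeadAt (v (k + 2)) (v (k + 1)))
    (h3 : G.arrow (v (k + 1)) (v (k + 3))) : G.DiscriminatedAt v (k + 1) := by
  have h4 : G.HeadAt (v (k + 2)) (v (k + 3)) := h2.trans_adj h3 (h.adj (k + 2) (by omega))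
  rcases exists_discriminating_or_shortcut (fun s hs => h.adj s (by omega)) h1 h3 with
    ⟨l, hl, -, h5, h6⟩ | ⟨l, hl, h5, h6⟩
  · refine ⟨l, by omega, h5, fun s hs hsk => ?_⟩
    rcases Nat.lt_succ_iff_lt_or_eq.1 hsk with hsk | rfl
    · exact h6 s hs hsk
    · exact ⟨⟨h1, h2⟩, h3⟩
  · refine (h.not_skip (l := l) (r := k + 3) (by omega) hk h5.adj ?_ ?_).elim
    · rintro s rfl
      exact (h.openAt s (by omega)).congr (h6 s rfl)
    · intro hk'
      refine (h.openAt (k + 2) hk').congr ?_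
      exact ⟨fun hc => ⟨h4, hc.2⟩, fun hc => ⟨h5, hc.2⟩⟩

/-- Every triple of a shortest open walk is unshielded or discriminated from one side. -/
theorem discriminatedAt (h : G.IsShortestWalk C v n) {m : ℕ} (hm : m + 2 ≤ n) :
    G.DiscriminatedAt v m ∨ G.DiscriminatedAt (fun k => v (n - k)) (n - (m + 2)) := by
  by_cases ha : G.skeleton.Adj (v m) (v (m + 2))
  swap
  · exact Or.inl ⟨m, le_rfl, ha, by omega⟩
  by_contra hcon
  obtain ⟨hL, hR⟩ := not_or.1 hcon
  have e1 := h.adj m (by omega)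
  have e2 := h.adj (m + 1) (by omega)
  -- at most one of the marks at `v m` and `v (m + 2)` that the chord changes matters
  have hLl : ∀ k, k + 1 = m → G.HeadAt (v k) (v m) → G.HeadAt (v (m + 1)) (v m) →
      ¬ G.arrow (v m) (v (m + 2)) := by
    rintro k rfl h1 h2 h3
    exact hL (h.discriminatedAt_of_arrow (by omega) h1 h2 h3)
  have hRr : m + 3 ≤ n → G.HeadAt (v (m + 3)) (v (m + 2)) → G.HeadAt (v (m + 1)) (v (m + 2)) →
      ¬ G.arrow (v (m + 2)) (v m) := by
    intro hm' h1 h2 h3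
    have := h.reverse.discriminatedAt_of_arrow (k := n - (m + 3)) (by omega)
    simp only [show n - (n - (m + 3)) = m + 3 by omega,
      show n - (n - (m + 2)) = m + 2 by omega, show n - (n - (m + 3) + 2) = m + 1 by omega,
      show n - (n - (m + 3) + 3) = m by omega, show n - (m + 3) + 1 = n - (m + 2) by omega] at this
    exact hR (this h1 h2 h3)
  -- If the chord makes `v m` a new collider, then `v (m + 1)` was an open collider and a child of
  -- `v m`, so `v m` is an ancestor of `C`.
  have hcol1 : G.arrow (v m) (v (m + 1)) → G.HeadAt (v (m + 2)) (v m) →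
      G.InAn C (v m) := by
    intro h1 h2
    have h3 : G.HeadAt (v (m + 2)) (v (m + 1)) := h2.trans_adj h1 e2.symm
    exact ((h.openAt m hm).1 ⟨Or.inl h1, h3⟩).of_arrow h1
  have hcol2 : G.arrow (v (m + 2)) (v (m + 1)) → G.HeadAt (v m) (v (m + 2)) →
      G.InAn C (v (m + 2)) := by
    intro h1 h2
    have h3 : G.HeadAt (v m) (v (m + 1)) := h2.trans_adj h1 e1
    exact ((h.openAt m hm).1 ⟨h3, Or.inl h1⟩).of_arrow h1
  refine h.not_skip (l := m) (r := m + 2) (by omega) hm ha ?_ ?_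
  · rintro k rfl
    have ho := h.openAt k (by omega)
    constructor
    · intro hc
      by_cases h1 : G.HeadAt (v (k + 2)) (v (k + 1))
      · exact ho.1 ⟨hc.1, h1⟩
      · exact hcol1 (arrow_of_not_headAt e1.symm h1) hc.2
    · intro hc
      refine ho.2 fun hc' => ?_
      refine hLl k rfl hc'.1 hc'.2 (arrow_of_not_headAt ha.symm fun h' => hc ⟨hc'.1, h'⟩)
  · intro hm'
    have ho := h.openAt (m + 1) (by omega)
    constructor
    · intro hc
      by_cases h1 : G.HeadAt (v (m + 1)) (v (m + 2))
      · exact ho.1 ⟨h1, hc.2⟩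
      · exact hcol2 (arrow_of_not_headAt e2 h1) hc.1
    · intro hc
      refine ho.2 fun hc' => ?_
      refine hRr (by omega) hc'.2 hc'.1 (arrow_of_not_headAt ha fun h' => hc ⟨h', hc'.2⟩)

end IsShortestWalk

/-! ### Graphs that agree on discriminated triples -/

variable (G H) in
/-- `G` and `H` agree on the triples that are unshielded, or discriminated by a path that is
discriminating in both graphs. -/
def SameDiscriminated : Prop :=
  ∀ (p : ℕ → V) (r : ℕ) (y : V), (∀ s t, s < t → t ≤ r + 1 → p s ≠ p t) →
    (∀ s ≤ r + 1, p s ≠ y) → (∀ s ≤ r, G.skeleton.Adj (p s) (p (s + 1))) →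
    G.skeleton.Adj (p (r + 1)) y → ¬ G.skeleton.Adj (p 0) y →
    (∀ s < r, (G.IsCollider (p s) (p (s + 1)) (p (s + 2)) ∧ G.arrow (p (s + 1)) y) ∧
      (H.IsCollider (p s) (p (s + 1)) (p (s + 2)) ∧ H.arrow (p (s + 1)) y)) →
    (G.IsCollider (p r) (p (r + 1)) y ↔ H.IsCollider (p r) (p (r + 1)) y)

theorem arrow_adj {a b : V} (h : G.arrow a b) : G.skeleton.Adj a b := Or.inl h

/-- A path that is discriminating in `G` and whose inner nodes are colliders in `H` is
discriminating in `H`. -/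
theorem SameDiscriminated.isCollider_iff (hD : G.SameDiscriminated H)
    (hsk : G.skeleton = H.skeleton) {v : ℕ → V} {l m : ℕ} {y : V}
    (hinj : ∀ s t, s < t → t ≤ m + 1 → v s ≠ v t) (hlm : l ≤ m) (hly : v l ≠ y)
    (hadj : ∀ s ≤ m, G.skeleton.Adj (v s) (v (s + 1))) (hmy : G.skeleton.Adj (v (m + 1)) y)
    (hnadj : ¬ G.skeleton.Adj (v l) y)
    (hcol : ∀ s, l ≤ s → s < m → G.IsCollider (v s) (v (s + 1)) (v (s + 2)) ∧
      G.arrow (v (s + 1)) y ∧ H.IsCollider (v s) (v (s + 1)) (v (s + 2))) :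
    G.IsCollider (v m) (v (m + 1)) y ↔ H.IsCollider (v m) (v (m + 1)) y := by
  induction m using Nat.strong_induction_on with
  | _ m ih =>
    -- The shorter path discriminates the triple of `v s`, `v (s + 1)`, `y`, a non-collider in `G`
    -- and hence in `H`. As `v s *→ v (s + 1)` in `H`, the other edge must leave `v (s + 1)`.
    have harrow : ∀ s, l ≤ s → s < m → H.arrow (v (s + 1)) y := by
      intro s hs hsm
      obtain ⟨h1, h2, h3⟩ := hcol s hs hsm
      have h4 := ih s hsm (fun a b hab hb => hinj a b hab (by omega)) hs
        (fun a ha => hadj a (by omega)) (arrow_adj h2)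
        fun a ha has => hcol a ha (by omega)
      refine arrow_of_not_headAt (hsk ▸ (arrow_adj h2).symm) fun h5 => ?_
      exact (h4.2 ⟨h3.1, h5⟩).2.not_arrow h2
    have key := hD (fun k => v (l + k)) (m - l) y (fun s t hst ht => hinj _ _ (by omega) (by omega))
      ?_ (fun s hs => hadj (l + s) (by omega)) ?_ hnadj ?_
    · simpa only [show l + (m - l) = m by omega, show l + (m - l + 1) = m + 1 by omega] using key
    · intro s hs
      rcases Nat.eq_zero_or_pos s with rfl | hs0
      · exact hly
      · rcases Nat.lt_succ_iff_lt_or_eq.1 (Nat.lt_succ_of_le hs) with hs' | rfl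
        · have := (hcol (l + s - 1) (by omega) (by omega)).2.1
          rw [show l + s - 1 + 1 = l + s by omega] at this
          exact (arrow_adj this).ne
        · simp only [show l + (m - l + 1) = m + 1 by omega]
          exact hmy.ne
    · simpa only [show l + (m - l + 1) = m + 1 by omega] using hmy
    · intro s hs
      obtain ⟨h1, h2, h3⟩ := hcol (l + s) (by omega) (by omega)
      exact ⟨⟨h1, h2⟩, h3, harrow (l + s) (by omega) (by omega)⟩

/-- The triple at `m + 1` has the same status in both graphs, unless a preceding collider of its
discriminating path has not. -/
theorem SameDiscriminated.exists_ne_of_discriminatedAt (hD : G.SameDiscriminated H)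
    (hsk : G.skeleton = H.skeleton) {v : ℕ → V} {m n : ℕ} (hv : G.IsShortestWalk C v n)
    (hm : m + 2 ≤ n) (h : G.DiscriminatedAt v m)
    (hne : ¬ (G.IsCollider (v m) (v (m + 1)) (v (m + 2)) ↔
      H.IsCollider (v m) (v (m + 1)) (v (m + 2)))) :
    ∃ l ≤ m, ¬ G.skeleton.Adj (v l) (v (m + 2)) ∧
      (∀ s, l ≤ s → s < m →
        G.IsCollider (v s) (v (s + 1)) (v (s + 2)) ∧ G.arrow (v (s + 1)) (v (m + 2))) ∧
      ∃ s, l ≤ s ∧ s < m ∧ ¬ (G.IsCollider (v s) (v (s + 1)) (v (s + 2)) ↔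
        H.IsCollider (v s) (v (s + 1)) (v (s + 2))) := by
  obtain ⟨l, hl, h1, h2⟩ := h
  refine ⟨l, hl, h1, h2, ?_⟩
  by_contra hcon
  push Not at hcon
  refine hne (hD.isCollider_iff hsk (fun s t hst ht => hv.ne hst.ne (by omega) (by omega)) hl
    (hv.ne (by omega) (by omega) hm) (fun s hs => hv.adj s (by omega)) (hv.adj (m + 1) (by omega))
    h1 fun s hs hsm => ?_)
  obtain ⟨h3, h4⟩ := h2 s hs hsm
  exact ⟨h3, h4, (hcon s hs hsm).1 h3⟩

/-- All triples of a shortest open walk have the same status in both graphs. -/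
theorem SameDiscriminated.isCollider_iff_of_isShortestWalk (hD : G.SameDiscriminated H)
    (hsk : G.skeleton = H.skeleton) (hG : G.InducingClosed) {v : ℕ → V} {n : ℕ}
    (hv : G.IsShortestWalk C v n) {m : ℕ} (hm : m + 2 ≤ n) :
    G.IsCollider (v m) (v (m + 1)) (v (m + 2)) ↔ H.IsCollider (v m) (v (m + 1)) (v (m + 2)) := by
  classical
  let Bad : ℕ → Prop := fun s => s + 2 ≤ n ∧ ¬ (G.IsCollider (v s) (v (s + 1)) (v (s + 2)) ↔
    H.IsCollider (v s) (v (s + 1)) (v (s + 2)))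
  let L : ℕ → Prop := fun s => Bad s ∧ ∃ l ≤ s, ¬ G.skeleton.Adj (v l) (v (s + 2)) ∧
      (∀ x, l ≤ x → x < s →
        G.IsCollider (v x) (v (x + 1)) (v (x + 2)) ∧ G.arrow (v (x + 1)) (v (s + 2))) ∧
      ∃ x, l ≤ x ∧ x < s ∧ Bad x
  -- `L` and `R` record on which side a bad triple depends on another bad one. Nonadjacency of the
  -- ends is needed for `L` only.
  let R : ℕ → Prop := fun s => Bad s ∧ ∃ r ≤ n,
      (∀ x, s < x → x + 2 ≤ r →
        G.IsCollider (v x) (v (x + 1)) (v (x + 2)) ∧ G.arrow (v (x + 1)) (v s)) ∧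
      ∃ x, s < x ∧ x + 2 ≤ r ∧ Bad x
  have hLR : ∀ s, Bad s → L s ∨ R s := by
    rintro s ⟨hs, hbad⟩
    rcases hv.discriminatedAt hs with h | h
    · obtain ⟨l, hl, h1, h2, x, hx, hxs, h3⟩ := hD.exists_ne_of_discriminatedAt hsk hv hs h hbad
      exact Or.inl ⟨⟨hs, hbad⟩, l, hl, h1, h2, x, hx, hxs, by omega, h3⟩
    · obtain ⟨l, hl, -, h2, x, hx, hxs, h3⟩ := hD.exists_ne_of_discriminatedAt hsk hv.reverse
        (by omega) h (by
          simpa only [show n - (n - (s + 2)) = s + 2 by omega,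
            show n - (n - (s + 2) + 1) = s + 1 by omega, show n - (n - (s + 2) + 2) = s by omega,
            isCollider_comm (u := v (s + 2))] using hbad)
      refine Or.inr ⟨⟨hs, hbad⟩, n - l, by omega, fun y hy hyr => ?_, n - (x + 2), by omega,
        by omega, by omega, ?_⟩
      · have := h2 (n - (y + 2)) (by omega) (by omega)
        simp only [show n - (n - (y + 2)) = y + 2 by omega,
            show n - (n - (y + 2) + 1) = y + 1 by omega, show n - (n - (y + 2) + 2) = y by omega,
            show n - (n - (s + 2) + 2) = s by omega] at this
        exact ⟨isCollider_comm.1 this.1, this.2⟩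
      · simpa only [show n - (x + 2) + 1 = n - (x + 1) by omega,
          show n - (x + 2) + 2 = n - x by omega, isCollider_comm (u := v (n - (x + 2)))] using h3
  by_contra hcon
  have hbad : Bad m := ⟨hm, hcon⟩
  -- the last bad triple depends on a preceding one
  have hexL : ∃ s, L s := by
    have hb := Nat.findGreatest_spec (P := Bad) (n := n) (by omega : m ≤ n) hbad
    refine ⟨_, (hLR _ hb).resolve_right ?_⟩
    rintro ⟨-, r, hr, -, x, hx, hxr, hbx⟩
    exact Nat.findGreatest_is_greatest hx (by omega) hbx
  obtain ⟨hbt, l, hlt, hnadj, hL, x, hlx, hxt, hbx⟩ := Nat.find_spec hexL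
  have hmin : ∀ s < Nat.find hexL, ¬ L s := fun s hs => Nat.find_min hexL hs
  generalize Nat.find hexL = t at hbt hlt hnadj hL hxt hmin
  have hbs := Nat.findGreatest_spec (P := Bad) (n := t - 1) (by omega : x ≤ t - 1) hbx
  have hxs := Nat.le_findGreatest (P := Bad) (n := t - 1) (by omega : x ≤ t - 1) hbx
  have hst := Nat.findGreatest_le (P := Bad) (t - 1)
  have hmax : ∀ k, Nat.findGreatest Bad (t - 1) < k → k ≤ t - 1 → ¬ Bad k :=
    fun k => Nat.findGreatest_is_greatest
  generalize Nat.findGreatest Bad (t - 1) = s at hbs hxs hst hmax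
  obtain ⟨-, r, hr, hR, z, hsz, hzr, hbz⟩ := (hLR s hbs).resolve_left (hmin s (by omega))
  -- With `t` the least index in `L` and `s` the last bad index before it, `s` depends on the right.
  -- No bad index lies strictly between them, so the two discriminating paths overlap.
  have htz : t ≤ z := by
    by_contra h
    exact hmax z hsz (by omega) hbz
  have htn := hbt.1
  obtain ⟨hcs, has⟩ := hL s (by omega) (by omega)
  obtain ⟨hct, hat⟩ := hR t (by omega) (by omega)
  -- Either path reaching further would create a directed path against an arrowhead. So they span
  -- the same segment, which is inducing although its ends are nonadjacent.
  have hrt : r = t + 2 := by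
    by_contra h
    have := (hR (t + 1) (by omega) (by omega)).2
    exact hcs.1.not_transGen ((Relation.TransGen.single has).tail this)
  have hls : l = s := by
    by_contra h
    have := (hL (s - 1) (by omega) (by omega)).2
    rw [show s - 1 + 1 = s by omega] at this
    exact hct.2.not_transGen ((Relation.TransGen.single hat).tail this)
  subst hls hrt
  have := hG (fun k => v (l + k)) (t + 2 - l) (hv.ne (by omega) (by omega) (by omega))
    (fun k hk => hv.adj (l + k) (by omega)) fun k hk => ?_
  · simp only [show l + (t + 2 - l) = t + 2 by omega] at this
    exact hnadj this
  · simp only [show l + (t + 2 - l) = t + 2 by omega]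
    rcases Nat.lt_or_ge (l + k) t with h | h
    · obtain ⟨h1, h2⟩ := hL (l + k) (by omega) h
      exact ⟨h1, Or.inr (.single h2)⟩
    · obtain rfl : t = l + k := by omega
      exact ⟨hct, Or.inl (.single hat)⟩

/-! ### Distance to `C` and transfer of open walks -/

variable (G C) in
/-- A node of `C` can be reached from `t` by `k` arrows. -/
def ReachIn : ℕ → V → Prop
  | 0, t => t ∈ C
  | k + 1, t => ∃ e, G.arrow t e ∧ ReachIn k e

theorem InAn.exists_reachIn {t : V} (h : G.InAn C t) : ∃ k, G.ReachIn C k t := by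
  rcases h with h | ⟨c, hc, h⟩
  · exact ⟨0, h⟩
  · change Relation.TransGen G.arrow t c at h
    induction h using Relation.TransGen.head_induction_on with
    | single h => exact ⟨1, c, h, hc⟩
    | head h _ ih =>
      obtain ⟨k, hk⟩ := ih
      exact ⟨k + 1, _, h, hk⟩

theorem ReachIn.inAn {k : ℕ} {t : V} (h : G.ReachIn C k t) : G.InAn C t := by
  induction k generalizing t with
  | zero => exact Or.inl h
  | succ k ih =>
    obtain ⟨e, he, h⟩ := h
    exact (ih h).of_arrow he

variable (G C) in
/-- The length of a shortest directed path from `t` to `C`. -/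
noncomputable def distTo (t : V) : ℕ := sInf {k | G.ReachIn C k t}

theorem InAn.reachIn_distTo {t : V} (h : G.InAn C t) : G.ReachIn C (G.distTo C t) t :=
  Nat.sInf_mem h.exists_reachIn

theorem distTo_le {t : V} {k : ℕ} (h : G.ReachIn C k t) : G.distTo C t ≤ k := Nat.sInf_le h

theorem exists_arrow_distTo {t : V} (h : G.InAn C t) (ht : t ∉ C) :
    ∃ e, G.arrow t e ∧ G.InAn C e ∧ G.distTo C e < G.distTo C t := by
  have h' := h.reachIn_distTo
  match hk : G.distTo C t, h' with
  | 0, h' => exact absurd h' ht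
  | k + 1, ⟨e, he, h'⟩ => exact ⟨e, he, h'.inAn, Nat.lt_succ_of_le (distTo_le h')⟩

/-- A shortest directed path of `G` to `C` is directed in `H` if its first arrow is. -/
theorem SameDiscriminated.inAn_of_arrow (hD : G.SameDiscriminated H)
    (hsk : G.skeleton = H.skeleton) {d e : V} (hde : G.arrow d e) (he : G.InAn C e)
    (hlt : G.distTo C e < G.distTo C d) (hde' : H.arrow d e) : H.InAn C d := by
  induction hk : G.distTo C e using Nat.strong_induction_on generalizing d e with
  | _ k ih =>
    refine InAn.of_arrow hde' ?_
    by_cases heC : e ∈ C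
    · exact Or.inl heC
    obtain ⟨f, hef, hf, hlt'⟩ := exists_arrow_distTo he heC
    refine ih _ (hk ▸ hlt') hef hf hlt' ?_ rfl
    have hdf : d ≠ f := by
      rintro rfl
      exact G.acyclic d ((Relation.TransGen.single hde).tail hef)
    -- An edge between `d` and `f` would have to be `d → f`, a shorter way to `C`. So the triple is
    -- unshielded, and its status is shared by `H`.
    have hndf : ¬ G.skeleton.Adj d f := by
      intro hadj
      have h1 : ¬ G.HeadAt f d := fun h =>
        h.not_transGen ((Relation.TransGen.single hde).tail hef)
      have h2 := arrow_of_not_headAt hadj.symm h1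
      have h3 : G.ReachIn C (G.distTo C f + 1) d := ⟨f, h2, hf.reachIn_distTo⟩
      have := distTo_le h3
      omega
    have key := hD.isCollider_iff hsk (v := fun k => if k = 0 then d else e) (l := 0) (m := 0)
      (y := f) ?_ le_rfl (by simpa using hdf) ?_ (by simpa using arrow_adj hef)
      (by simpa using hndf) (by omega)
    · simp only [if_true, zero_add, one_ne_zero, if_false] at key
      refine arrow_of_not_headAt (hsk ▸ (arrow_adj hef).symm) fun h => ?_
      exact (key.2 ⟨Or.inl hde', h⟩).2.not_arrow hef
    · intro s t hst ht
      obtain ⟨rfl, rfl⟩ : s = 0 ∧ t = 1 := by omega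
      simpa using (arrow_adj hde).ne
    · intro s hs
      obtain rfl : s = 0 := by omega
      simpa using arrow_adj hde

open Classical in
variable (G C) in
/-- The sum of the distances of the colliders of a walk from `C`. -/
noncomputable def colliderCost (v : ℕ → V) (n : ℕ) : ℕ :=
  ∑ k ∈ Finset.range (n - 1),
    if G.IsCollider (v k) (v (k + 1)) (v (k + 2)) then G.distTo C (v (k + 1)) else 0

/-- The cost breaks ties among shortest walks: replacing one collider by a node nearer to `C` does
not change the length. -/
theorem exists_isShortestWalk_minimal_cost {v : ℕ → V} {n : ℕ} (h : G.IsOpenWalk C v n) :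
    ∃ w m, G.IsShortestWalk C w m ∧ w 0 = v 0 ∧ w m = v n ∧
      ∀ w', G.IsOpenWalk C w' m → w' 0 = w 0 → w' m = w m →
        G.colliderCost C w m ≤ G.colliderCost C w' m := by
  classical
  obtain ⟨u, m, hu, h0, hm, hmin⟩ := exists_minimal_isOpenWalk h
  have hex : ∃ c, ∃ w, G.IsOpenWalk C w m ∧ w 0 = u 0 ∧ w m = u m ∧ G.colliderCost C w m = c :=
    ⟨_, u, hu, rfl, rfl, rfl⟩
  obtain ⟨w, hw, hw0, hwm, hc⟩ := Nat.find_spec hex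
  refine ⟨w, m, ⟨hw, fun w' m' hw' e0 em => hmin w' m' hw' (e0.trans hw0) (em.trans hwm)⟩,
    hw0.trans h0, hwm.trans hm, fun w' hw' e0 em => ?_⟩
  rw [hc]
  exact Nat.find_min' hex ⟨w', hw', e0.trans hw0, em.trans hwm, rfl⟩

/-- Replacing the nodes strictly between the `l`-th and the `r`-th by one node `e`. -/
theorem IsOpenWalk.replace {v : ℕ → V} {n : ℕ} (h : G.IsOpenWalk C v n) {l r : ℕ} {e : V}
    (hlr : l + 2 ≤ r) (hr : r ≤ n) (h1 : G.HeadAt (v l) e) (h2 : G.HeadAt (v r) e)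
    (he : G.InAn C e)
    (hl : ∀ k, k + 1 = l → G.OpenAt C (v k) (v l) e)
    (hr' : r + 1 ≤ n → G.OpenAt C e (v r) (v (r + 1))) :
    G.IsOpenWalk C (fun k => if k ≤ l then v k else if k = l + 1 then e else v (k + (r - l - 2)))
      (n - (r - l - 2)) where
  adj k hk := by
    rcases lt_trichotomy k l with hkl | rfl | hkl
    · simp only [hkl.le, if_true, show k + 1 ≤ l by omega]
      exact h.adj k (by omega)
    · simpa using h1.adj
    · rcases (show k = l + 1 ∨ l + 1 < k by omega) with rfl | hk1
      · simpa [show l + 1 + 1 + (r - l - 2) = r by omega] using h2.adj.symm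
      · simp only [show ¬ k ≤ l by omega, if_false, show ¬ k + 1 ≤ l by omega,
          show ¬ k = l + 1 by omega, show ¬ k + 1 = l + 1 by omega]
        have := h.adj (k + (r - l - 2)) (by omega)
        rwa [show k + (r - l - 2) + 1 = k + 1 + (r - l - 2) by omega] at this
  openAt k hk := by
    rcases (show k + 2 ≤ l ∨ k + 1 = l ∨ k = l ∨ k = l + 1 ∨ l + 1 < k by omega) with
      hkl | hkl | rfl | rfl | hkl
    · simp only [show k ≤ l by omega, if_true, show k + 1 ≤ l by omega, hkl]
      exact h.openAt k (by omega)
    · subst hkl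
      simpa using hl k rfl
    · simp only [le_refl, if_true, show ¬ k + 1 ≤ k by omega, if_false, show ¬ k + 2 ≤ k by omega,
        show ¬ k + 2 = k + 1 by omega, show k + 2 + (r - k - 2) = r by omega]
      exact ⟨fun _ => he, fun hc => absurd ⟨h1, h2⟩ hc⟩
    · simpa [show l + 1 + 1 + (r - l - 2) = r by omega, show ¬ l + 1 + 2 ≤ l by omega,
        show l + 1 + 2 + (r - l - 2) = r + 1 by omega] using hr' (by omega)
    · simp only [show ¬ k ≤ l by omega, if_false, show ¬ k + 1 ≤ l by omega,
        show ¬ k + 2 ≤ l by omega, show ¬ k = l + 1 by omega, show ¬ k + 1 = l + 1 by omega,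
        show ¬ k + 2 = l + 1 by omega]
      have := h.openAt (k + (r - l - 2)) (by omega)
      rwa [show k + (r - l - 2) + 1 = k + 1 + (r - l - 2) by omega,
        show k + (r - l - 2) + 2 = k + 2 + (r - l - 2) by omega] at this

/-- Replacing a collider by a node nearer to `C` lowers the cost. -/
theorem colliderCost_lt {v w : ℕ → V} {n m : ℕ} (hm : m + 2 ≤ n)
    (hw : ∀ k ≤ n, k ≠ m + 1 → w k = v k) (hcol : G.IsCollider (v m) (v (m + 1)) (v (m + 2)))
    (hlt : G.distTo C (w (m + 1)) < G.distTo C (v (m + 1)))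
    (hl : ∀ k, k + 1 = m → (G.IsCollider (v k) (v m) (w (m + 1)) ↔
      G.IsCollider (v k) (v m) (v (m + 1))))
    (hr : m + 3 ≤ n → (G.IsCollider (w (m + 1)) (v (m + 2)) (v (m + 3)) ↔
      G.IsCollider (v (m + 1)) (v (m + 2)) (v (m + 3)))) :
    G.colliderCost C w n < G.colliderCost C v n := by
  classical
  have hterm : G.distTo C (w (m + 1)) < if G.IsCollider (v m) (v (m + 1)) (v (m + 2)) then
      G.distTo C (v (m + 1)) else 0 := by rwa [if_pos hcol]
  unfold colliderCost
  refine Finset.sum_lt_sum (fun k hk => ?_) ⟨m, by simp; omega, ?_⟩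
  · have hk := Finset.mem_range.1 hk
    rcases (show k + 1 = m ∨ k = m ∨ k = m + 1 ∨ (k + 2 ≠ m + 1 ∧ k ≠ m ∧ k ≠ m + 1) by omega)
      with hkm | rfl | rfl | ⟨h0, h1, h2⟩
    · have := hl k hkm
      subst hkm
      rw [hw k (by omega) (by omega), hw (k + 1) (by omega) (by omega)]
      refine le_of_eq (if_congr ?_ rfl rfl)
      exact this
    · refine le_trans ?_ hterm.le
      split_ifs
      · exact le_rfl
      · exact Nat.zero_le _
    · have := hr (by omega)
      rw [hw (m + 1 + 1) (by omega) (by omega), hw (m + 1 + 2) (by omega) (by omega)]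
      exact le_of_eq (if_congr this rfl rfl)
    · rw [hw k (by omega) h2, hw (k + 1) (by omega) (by omega), hw (k + 2) (by omega) (by omega)]
  · refine lt_of_le_of_lt ?_ hterm
    split_ifs
    · exact le_rfl
    · exact Nat.zero_le _

/-- The triple `v m`, `v (m + 1)`, `e` is a discriminated non-collider in both graphs. In `H` there
is still an arrowhead at `v (m + 1)` from `v m`, so the edge to `e` must point away. -/
theorem SameDiscriminated.arrow_of_isCollider (hD : G.SameDiscriminated H)
    (hsk : G.skeleton = H.skeleton) {v : ℕ → V} {n l m : ℕ} {e : V} (hv : G.IsShortestWalk C v n)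
    (hcol : ∀ s, s + 2 ≤ n → (G.IsCollider (v s) (v (s + 1)) (v (s + 2)) ↔
      H.IsCollider (v s) (v (s + 1)) (v (s + 2))))
    (hm : m + 2 ≤ n) (hmcol : G.IsCollider (v m) (v (m + 1)) (v (m + 2)))
    (he : G.arrow (v (m + 1)) e) (hlm : l ≤ m) (hle : v l ≠ e) (hnadj : ¬ G.skeleton.Adj (v l) e)
    (hdisc : ∀ s, l ≤ s → s < m →
      G.IsCollider (v s) (v (s + 1)) (v (s + 2)) ∧ G.arrow (v (s + 1)) e) :
    H.arrow (v (m + 1)) e := by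
  have key := hD.isCollider_iff hsk (fun s t hst ht => hv.ne hst.ne (by omega) (by omega)) hlm hle
    (fun s hs => hv.adj s (by omega)) (arrow_adj he) hnadj fun s hs hsm =>
      ⟨(hdisc s hs hsm).1, (hdisc s hs hsm).2, (hcol s (by omega)).1 (hdisc s hs hsm).1⟩
  refine arrow_of_not_headAt (hsk ▸ (arrow_adj he).symm) fun h => ?_
  exact (key.2 ⟨((hcol m hm).1 hmcol).1, h⟩).2.not_arrow he

/-- Open walks transfer between graphs that agree on discriminated triples. -/
theorem SameDiscriminated.exists_isOpenWalk (hD : G.SameDiscriminated H)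
    (hsk : G.skeleton = H.skeleton) (hG : G.InducingClosed) {v : ℕ → V} {n : ℕ}
    (hv : G.IsOpenWalk C v n) : ∃ w m, H.IsOpenWalk C w m ∧ w 0 = v 0 ∧ w m = v n := by
  obtain ⟨w, n, hw, h0, hn, hcost⟩ := exists_isShortestWalk_minimal_cost hv
  refine ⟨w, n, ?_, h0, hn⟩
  clear h0 hn hv v
  have hcol : ∀ s, s + 2 ≤ n → (G.IsCollider (w s) (w (s + 1)) (w (s + 2)) ↔
      H.IsCollider (w s) (w (s + 1)) (w (s + 2))) :=
    fun s hs => hD.isCollider_iff_of_isShortestWalk hsk hG hw hs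
  refine ⟨fun k hk => hsk ▸ hw.adj k hk, fun m hm => ?_⟩
  refine ⟨fun hc => ?_, fun hc => (hw.openAt m hm).2 ((hcol m hm).not.2 hc)⟩
  have hcG := (hcol m hm).2 hc
  have hin := (hw.openAt m hm).1 hcG
  by_cases hC : w (m + 1) ∈ C
  · exact Or.inl hC
  obtain ⟨e, he, heC, hlt⟩ := exists_arrow_distTo hin hC
  refine hD.inAn_of_arrow hsk he heC hlt ?_
  have hrev := exists_discriminating_or_shortcut (v := fun k => w (n - k)) (k := n - (m + 2))
    (y := e) (fun s hs => hw.reverse.adj s (by omega))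
    (by simpa only [show n - (n - (m + 2)) = m + 2 by omega,
      show n - (n - (m + 2) + 1) = m + 1 by omega] using hcG.2)
    (by simpa only [show n - (n - (m + 2) + 1) = m + 1 by omega] using he)
  rcases exists_discriminating_or_shortcut (fun s hs => hw.adj s (by omega)) hcG.1 he with
    ⟨l, hl, h1, h2, h3⟩ | ⟨l, hl, h1, h2⟩
  · exact hD.arrow_of_isCollider hsk hw hcol hm hcG he hl h1 h2 h3
  rcases hrev with ⟨r, hr, h3, h4, h5⟩ | ⟨r, hr, h3, h4⟩
  · have := hD.arrow_of_isCollider hsk hw.reverse (l := r) (m := n - (m + 2)) (e := e) ?_ (by omega)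
      (by simpa only [show n - (n - (m + 2)) = m + 2 by omega,
        show n - (n - (m + 2) + 1) = m + 1 by omega,
        show n - (n - (m + 2) + 2) = m by omega] using isCollider_comm.1 hcG)
      (by simpa only [show n - (n - (m + 2) + 1) = m + 1 by omega] using he) hr h3 h4 h5
    · simpa only [show n - (n - (m + 2) + 1) = m + 1 by omega] using this
    · intro s hs
      have := hcol (n - (s + 2)) (by omega)
      simpa only [show n - (s + 2) + 1 = n - (s + 1) by omega,
          show n - (s + 2) + 2 = n - s by omega, isCollider_comm (u := w (n - (s + 2)))] using this
  -- Shortcuts on both sides give `v l *→ e ←* v r`. Routing through `e` shortens the walk, or, if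
  -- only `w (m + 1)` is replaced, lowers its cost.
  exfalso
  obtain ⟨r, hrn, rfl⟩ : ∃ r' ≤ n, r = n - r' := ⟨n - r, by omega, by omega⟩
  simp only [show n - (n - r) = r by omega, show n - (n - r + 1) = r - 1 by omega] at h3 h4
  have h4' : r + 1 ≤ n → (G.IsCollider e (w r) (w (r + 1)) ↔
      G.IsCollider (w (r - 1)) (w r) (w (r + 1))) := by
    intro hrn'
    have := h4 (n - (r + 1)) (by omega)
    rw [show n - (n - (r + 1)) = r + 1 by omega] at this
    rw [isCollider_comm, this, isCollider_comm]
  have hwalk := hw.replace (l := l) (r := r) (by omega) hrn h1 h3 heC ?_ ?_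
  · by_cases hlr : r = l + 2
    · obtain rfl : l = m := by omega
      subst hlr
      simp only [show l + 2 - l - 2 = 0 by omega, Nat.sub_zero, Nat.add_zero] at hwalk
      refine (hcost _ hwalk (by simp) ?_).not_gt (colliderCost_lt hm ?_ hcG ?_ ?_ ?_)
      · simp [show ¬ n ≤ l by omega, show ¬ n = l + 1 by omega]
      · intro k _ hk
        simp [hk]
      · simpa using hlt
      · intro k hk
        simpa using h2 k hk
      · intro hn
        simpa using h4' hn
    · have := hw.le_of_isOpenWalk _ _ hwalk (by simp) (by
        simp only [show ¬ n - (r - l - 2) ≤ l by omega, if_false,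
          show ¬ n - (r - l - 2) = l + 1 by omega]
        congr 1; omega)
      omega
  · rintro k rfl
    exact (hw.openAt k (by omega)).congr (h2 k rfl)
  · intro hrn'
    refine OpenAt.congr ?_ (h4' hrn')
    have := hw.openAt (r - 1) (by omega)
    rwa [show r - 1 + 1 = r by omega, show r - 1 + 2 = r + 1 by omega] at this

theorem SameDiscriminated.symm (hD : G.SameDiscriminated H) (hsk : G.skeleton = H.skeleton) :
    H.SameDiscriminated G := by
  intro p r y h1 h2 h3 h4 h5 h6
  rw [← hsk] at h3 h4 h5
  exact (hD p r y h1 h2 h3 h4 h5 fun s hs => (h6 s hs).symm).symm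

theorem SameDiscriminated.indep_of_indep (hD : G.SameDiscriminated H)
    (hsk : G.skeleton = H.skeleton) (hG : G.InducingClosed) {A B C : Set V}
    (h : H.indepModel.Indep A B C) : G.indepModel.Indep A B C := by
  refine ⟨h.1, ?_⟩
  rintro a ha b hb ⟨p, h0, h1, hp⟩
  obtain ⟨v, n, hv, rfl, rfl⟩ := exists_isOpenWalk_of_isConnecting h0 h1 hp
  obtain ⟨w, m, hw, e0, em⟩ := hD.exists_isOpenWalk hsk hG hv
  obtain ⟨q, hq⟩ := hw.exists_isConnecting
  rw [e0, em] at hq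
  exact h.2 _ ha _ hb ⟨q, hq⟩

/-- Graphs without nonadjacent inducing paths that have the same skeleton and agree on
discriminated triples are Markov equivalent. -/
theorem SameDiscriminated.markovEquivalent (hD : G.SameDiscriminated H)
    (hsk : G.skeleton = H.skeleton) (hG : G.InducingClosed) (hH : H.InducingClosed) :
    G.MarkovEquivalent H := by
  refine IndependenceModel.ext ?_
  funext A B C
  exact propext ⟨(hD.symm hsk).indep_of_indep hsk.symm hH, hD.indep_of_indep hsk hG⟩

end AncestralGraph

/-! ### Consequences of ordered stability, path-stability and V-stability -/

namespace IndependenceModel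

variable {V : Type*} {J : IndependenceModel V} {G : AncestralGraph V}

theorem Indep.notMem {i j : V} {C : Set V} (h : J.Indep {i} {j} C) :
    i ≠ j ∧ i ∉ C ∧ j ∉ C := by
  simpa using J.disjoint _ _ _ h

variable [Finite V]

theorem OrderedUpwardStable.union (hJ : J.OrderedUpwardStable G.minimalOrder) {i j : V}
    {C S : Set V} (h : J.Indep {i} {j} C) (hS : S ⊆ G.jointAn i j) :
    J.Indep {i} {j} (C ∪ S) := by
  induction S, S.toFinite using Set.Finite.induction_on with
  | empty => simpa using h
  | @insert k S _ _ ih =>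
    obtain ⟨hk, hkij⟩ := hS (Set.mem_insert k S)
    simp only [Set.mem_insert_iff, Set.mem_singleton_iff, not_or] at hkij
    have := hJ i j _ (ih ((Set.subset_insert k S).trans hS)) k hkij.1 hkij.2 hk
    rwa [Set.union_assoc, Set.union_singleton] at this

theorem OrderedDownwardStable.indep_jointAn (hJ : J.OrderedDownwardStable G.minimalOrder) {i j : V}
    {C : Set V} (h : J.Indep {i} {j} C) (hC : G.jointAn i j ⊆ C) :
    J.Indep {i} {j} (G.jointAn i j) := by
  induction hn : (C \ G.jointAn i j).ncard using Nat.strong_induction_on generalizing C with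
  | _ n ih =>
    rcases (C \ G.jointAn i j).eq_empty_or_nonempty with he | hne
    · rwa [hC.antisymm (Set.sdiff_eq_empty.1 he)]
    -- A superfluous node that is an ancestor of no other superfluous node can be removed: it is not
    -- an ancestor of a node in `an(i, j)` either, as it would then belong to that set.
    obtain ⟨k, hk, hmin⟩ : ∃ k ∈ C \ G.jointAn i j, ∀ l ∈ C \ G.jointAn i j, k ∉ G.an l := by
      let _ := G.minimalOrder
      obtain ⟨k, hk⟩ := (Set.toFinite (C \ G.jointAn i j)).exists_minimal hne
      exact ⟨k, hk.prop, fun l hl hlk => hk.not_lt hl hlk⟩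
    have hki : k ≠ i := by
      rintro rfl
      exact h.notMem.2.1 hk.1
    have hkj : k ≠ j := by
      rintro rfl
      exact h.notMem.2.2 hk.1
    have hkij : ∀ l, k ∈ G.an l → l ∉ G.jointAn i j ∧ l ≠ i ∧ l ≠ j := by
      intro l hl
      refine ⟨fun h' => ?_, ?_, ?_⟩
      · exact hk.2 ⟨h'.1.imp (fun h' => Relation.TransGen.trans hl h')
          fun h' => Relation.TransGen.trans hl h', by simp [hki, hkj]⟩
      · rintro rfl
        exact hk.2 ⟨Or.inl hl, by simp [hki, hkj]⟩
      · rintro rfl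
        exact hk.2 ⟨Or.inr hl, by simp [hki, hkj]⟩
    have hstep := hJ i j C h k hki hkj (fun h' => (hkij i h').2.1 rfl)
      (fun h' => (hkij j h').2.2 rfl) fun l hl hlk => hmin l ⟨hl.1, (hkij l hlk).1⟩ hlk
    refine ih _ ?_ hstep (fun x hx => ⟨hC hx, ?_⟩) rfl
    · rw [← hn]
      refine Set.ncard_lt_ncard ⟨fun x hx => ⟨hx.1.1, hx.2⟩, fun hsub => ?_⟩ (Set.toFinite _)
      exact (hsub hk).1.2 rfl
    · rintro rfl
      exact hk.2 hx

theorem OrderedStable.indep_jointAn (hJ : J.OrderedStable G) {i j : V} {C : Set V}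
    (h : J.Indep {i} {j} C) : J.Indep {i} {j} (G.jointAn i j) :=
  hJ.2.indep_jointAn (hJ.1.union h subset_rfl) Set.subset_union_right

theorem skeleton_eq_of_isMaximal (hMarkov : J.Markovian G) (hConv : J.ConversePairwiseMarkovian G)
    (hJ : J.OrderedStable G) (hG : G.IsMaximal) : G.skeleton = J.skeleton := by
  ext i j
  refine ⟨fun h => ⟨h.ne, ?_⟩, fun h => ?_⟩
  · rintro ⟨C, -, -, hC | hC⟩
    · exact hConv _ _ (hJ.indep_jointAn hC) h
    · exact hConv _ _ (hJ.indep_jointAn hC) h.symm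
  · by_contra hn
    obtain ⟨C, hC⟩ := hG i j h.1 hn
    have := hMarkov _ _ _ hC
    exact h.2 ⟨C, this.notMem.2.1, this.notMem.2.2, Or.inl this⟩

/-- If the status of a discriminated triple is not the same in two graphs with respect to which
`J` is stable, then `J` is path-unstable along the discriminating path. -/
theorem exists_indep_of_isCollider {H : AncestralGraph V} (hG : G.InducingClosed)
    (hJG : J.OrderedStable G) (hJH : J.OrderedStable H)
    {p : ℕ → V} {r : ℕ} {y : V} (hinj : ∀ s t, s < t → t ≤ r + 1 → p s ≠ p t)
    (hpy : ∀ s ≤ r + 1, p s ≠ y) (hadj : ∀ s ≤ r, G.skeleton.Adj (p s) (p (s + 1)))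
    (hadjH : ∀ s ≤ r, H.skeleton.Adj (p s) (p (s + 1)))
    (hy : G.skeleton.Adj (p (r + 1)) y) (hyH : H.skeleton.Adj (p (r + 1)) y)
    (h0 : ¬ G.skeleton.Adj (p 0) y)
    (hd : ∀ s < r, (G.IsCollider (p s) (p (s + 1)) (p (s + 2)) ∧ G.arrow (p (s + 1)) y) ∧
      (H.IsCollider (p s) (p (s + 1)) (p (s + 2)) ∧ H.arrow (p (s + 1)) y))
    (hG' : G.IsCollider (p r) (p (r + 1)) y) (hH' : ¬ H.IsCollider (p r) (p (r + 1)) y)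
    {D : Set V} (hD : J.Indep {p 0} {y} D) :
    ∃ C : Set V, Disjoint C {p 0, y, p (r + 1)} ∧
      J.Indep {p 0} {y} ({x | ∃ s < r, p (s + 1) = x} ∪ C) ∧
      J.Indep {p 0} {y} ({x | ∃ s < r, p (s + 1) = x} ∪ C ∪ {p (r + 1)}) := by
  have hk0 : p (r + 1) ≠ p 0 := (hinj 0 (r + 1) (by omega) le_rfl).symm
  have hky : p (r + 1) ≠ y := hpy _ le_rfl
  have hUH : ∀ s < r, p (s + 1) ∈ H.jointAn (p 0) y := fun s hs =>
    ⟨Or.inr (.single (hd s hs).2.2), by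
      simp [(hinj 0 (s + 1) (by omega) (by omega)).symm, hpy (s + 1) (by omega)]⟩
  have hkH : p (r + 1) ∈ H.jointAn (p 0) y := by
    refine ⟨?_, by simp [hk0, hky]⟩
    rcases not_and_or.1 hH' with h | h
    · have h := AncestralGraph.arrow_of_not_headAt (hadjH r le_rfl) h
      rcases Nat.eq_zero_or_pos r with rfl | hr
      · exact Or.inl (.single h)
      · have := (hd (r - 1) (by omega)).2.2
        rw [show r - 1 + 1 = r by omega] at this
        exact Or.inr ((Relation.TransGen.single h).tail this)
    · exact Or.inr (.single (AncestralGraph.arrow_of_not_headAt hyH.symm h))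
  -- Otherwise all inner nodes of the path through `p (r + 1)` to `y` would be colliders and
  -- ancestors of an endpoint, making `p 0` and `y` adjacent.
  have hkG : p (r + 1) ∉ G.jointAn (p 0) y := by
    intro hk
    have := hG (fun s => if s ≤ r + 1 then p s else y) (r + 2) (by simpa using hpy 0 (by omega))
      (fun s hs => ?_) (fun s hs => ?_)
    · simp only [Nat.zero_le, if_true, show ¬ r + 2 ≤ r + 1 by omega, if_false] at this
      exact h0 this
    · rcases Nat.lt_succ_iff_lt_or_eq.1 hs with hs | rfl
      · simpa [show s ≤ r by omega, show s ≤ r + 1 by omega] using hadj s (by omega)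
      · simpa using hy
    · rcases (show s < r ∨ s = r by omega) with hs' | rfl
      · simp only [show s ≤ r + 1 by omega, show s + 1 ≤ r + 1 by omega,
          show s + 2 ≤ r + 1 by omega, if_true, show ¬ r + 2 ≤ r + 1 by omega, if_false]
        exact ⟨(hd s hs').1.1, Or.inr (.single (hd s hs').1.2)⟩
      · simp only [show s ≤ s + 1 by omega, if_true, le_refl, show ¬ s + 2 ≤ s + 1 by omega,
          if_false, Nat.zero_le]
        exact ⟨hG', hk.1⟩
  have hGi := hJG.indep_jointAn hD
  have h1 := hJH.1.union hGi (S := H.jointAn (p 0) y \ {p (r + 1)}) Set.sdiff_subset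
  have h2 := hJH.1.union hGi subset_rfl
  have hU : ∀ x ∈ {x | ∃ s < r, p (s + 1) = x}, x ∈ H.jointAn (p 0) y ∧ x ≠ p (r + 1) := by
    rintro _ ⟨s, hs, rfl⟩
    exact ⟨hUH s hs, hinj _ _ (by omega) le_rfl⟩
  generalize {x | ∃ s < r, p (s + 1) = x} = U at hU
  generalize p (r + 1) = k at *
  -- Since `U` lies in the joint ancestors in `H`, and `k` is a joint ancestor in `H` but not in
  -- `G`, adding `U`, or `U` and `k`, to this set recovers the conditioning sets of `h1` and `h2`.
  refine ⟨(G.jointAn (p 0) y ∪ H.jointAn (p 0) y) \ ({k} ∪ U), ?_, ?_, ?_⟩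
  · rw [Set.disjoint_left]
    rintro x ⟨hx, hx'⟩ (rfl | rfl | rfl)
    · rcases hx with hx | hx <;> exact hx.2 (by simp)
    · rcases hx with hx | hx <;> exact hx.2 (by simp)
    · exact hx' (by simp)
  · convert h1 using 1
    ext x
    have hx : x ∈ G.jointAn (p 0) y → x ≠ k := fun hx h => hkG (h ▸ hx)
    have := hU x
    simp only [Set.mem_union, Set.mem_sdiff, Set.mem_singleton_iff]
    by_cases x ∈ U <;> tauto
  · convert h2 using 1
    ext x
    have hx : x = k → x ∈ H.jointAn (p 0) y := fun h => h ▸ hkH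
    have := hU x
    simp only [Set.mem_union, Set.mem_sdiff, Set.mem_singleton_iff]
    by_cases x ∈ U <;> by_cases x = k <;> tauto

theorem PathStable.isCollider_of_isCollider {H : AncestralGraph V} (hP : J.PathStable)
    (hG : G.InducingClosed) (hJG : J.OrderedStable G) (hJH : J.OrderedStable H)
    (hsG : G.skeleton = J.skeleton) (hsH : H.skeleton = J.skeleton)
    (hind : ∀ i j, i ≠ j → ¬ J.skeleton.Adj i j → ∃ D, J.Indep {i} {j} D)
    {p : ℕ → V} {r : ℕ} {y : V} (hinj : ∀ s t, s < t → t ≤ r + 1 → p s ≠ p t)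
    (hpy : ∀ s ≤ r + 1, p s ≠ y) (hadj : ∀ s ≤ r, J.skeleton.Adj (p s) (p (s + 1)))
    (hy : J.skeleton.Adj (p (r + 1)) y) (h0 : ¬ J.skeleton.Adj (p 0) y)
    (hd : ∀ s < r, (G.IsCollider (p s) (p (s + 1)) (p (s + 2)) ∧ G.arrow (p (s + 1)) y) ∧
      (H.IsCollider (p s) (p (s + 1)) (p (s + 2)) ∧ H.arrow (p (s + 1)) y))
    (hG' : G.IsCollider (p r) (p (r + 1)) y) : H.IsCollider (p r) (p (r + 1)) y := by
  by_contra hH'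
  obtain ⟨D, hD⟩ := hind _ _ (hpy 0 (by omega)) h0
  obtain ⟨C, hC, h1, h2⟩ := exists_indep_of_isCollider hG hJG hJH hinj hpy
    (by rwa [hsG]) (by rwa [hsH]) (by rwa [hsG]) (by rwa [hsH]) (by rwa [hsG]) hd hG' hH' hD
  have hU : {x | x ∈ (List.range r).map fun s => p (s + 1)} = {x | ∃ s < r, p (s + 1) = x} := by
    ext x
    simp
  have hlist : p 0 :: ((List.range r).map (fun s => p (s + 1)) ++ [p (r + 1), y]) =
      (List.range (r + 3)).map fun s => if s ≤ r + 1 then p s else y := by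
    rw [List.range_succ_eq_map, List.map_cons, List.map_map, List.range_succ, List.range_succ]
    simp only [Nat.zero_le, if_true, List.map_append, List.map_cons, List.map_nil,
      Function.comp_apply, Nat.succ_eq_add_one, le_refl, show ¬ r + 1 + 1 ≤ r + 1 by omega,
      if_false, List.append_assoc, List.cons_append, List.nil_append]
    congr 2
    refine List.map_congr_left fun s hs => ?_
    have := List.mem_range.1 hs
    simp [show s ≤ r by omega]
  refine hP ⟨p 0, p (r + 1), y, (List.range r).map fun s => p (s + 1), ⟨?_, ?_⟩, h0, ?_, C, hC,
    ?_, ?_⟩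
  · rw [hlist]
    refine List.Nodup.map_on ?_ List.nodup_range
    have key : ∀ a b, a < b → b < r + 3 →
        (if a ≤ r + 1 then p a else y) ≠ if b ≤ r + 1 then p b else y := by
      intro a b hab hb
      rw [if_pos (by omega)]
      split_ifs with h
      · exact hinj a b hab h
      · exact hpy a (by omega)
    intro a ha b hb e
    rw [List.mem_range] at ha hb
    rcases lt_trichotomy a b with hab | hab | hab
    · exact absurd e (key a b hab hb)
    · exact hab
    · exact absurd e.symm (key b a hab ha)
  · rw [hlist, List.isChain_iff_getElem]
    intro k hk
    simp only [List.length_map, List.length_range] at hk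
    simp only [List.getElem_map, List.getElem_range]
    rcases (show k ≤ r ∨ k = r + 1 by omega) with hk | rfl
    · simpa [hk, show k ≤ r + 1 by omega] using hadj k hk
    · simpa using hy
  · simp only [List.mem_map, List.mem_range]
    rintro _ ⟨s, hs, rfl⟩
    rw [← hsG]
    exact AncestralGraph.arrow_adj (hd s hs).1.2
  · rwa [hU]
  · rwa [hU]

theorem PathStable.sameDiscriminated {H : AncestralGraph V} (hP : J.PathStable)
    (hG : G.InducingClosed) (hH : H.InducingClosed) (hJG : J.OrderedStable G)
    (hJH : J.OrderedStable H) (hsG : G.skeleton = J.skeleton) (hsH : H.skeleton = J.skeleton)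
    (hind : ∀ i j, i ≠ j → ¬ J.skeleton.Adj i j → ∃ D, J.Indep {i} {j} D) :
    G.SameDiscriminated H := by
  intro p r y hinj hpy hadj hy h0 hd
  rw [hsG] at hadj hy h0
  exact ⟨hP.isCollider_of_isCollider hG hJG hJH hsG hsH hind hinj hpy hadj hy h0 hd,
    hP.isCollider_of_isCollider hH hJH hJG hsH hsG hind hinj hpy hadj hy h0
      fun s hs => (hd s hs).symm⟩

theorem VStable.isCollider_of_isCollider {H : AncestralGraph V} (hP : J.VStable)
    (hG : G.InducingClosed) (hJG : J.OrderedStable G) (hJH : J.OrderedStable H)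
    (hsG : G.skeleton = J.skeleton) (hsH : H.skeleton = J.skeleton)
    (hind : ∀ i j, i ≠ j → ¬ J.skeleton.Adj i j → ∃ D, J.Indep {i} {j} D) {i k j : V}
    (hik : J.skeleton.Adj i k) (hkj : J.skeleton.Adj k j) (hij : i ≠ j)
    (hnadj : ¬ J.skeleton.Adj i j) (hG' : G.IsCollider i k j) : H.IsCollider i k j := by
  by_contra hH'
  obtain ⟨D, hD⟩ := hind _ _ hij hnadj
  obtain ⟨C, hC, h1, h2⟩ := exists_indep_of_isCollider hG hJG hJH
    (p := fun s => if s = 0 then i else k) (r := 0) (y := j)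
    (by
      intro s t hst ht
      obtain ⟨rfl, rfl⟩ : s = 0 ∧ t = 1 := by omega
      simpa using hik.ne)
    (by
      intro s _
      by_cases h : s = 0
      · simpa [h] using hij
      · simpa [h] using hkj.ne)
    (by
      intro s hs
      obtain rfl : s = 0 := by omega
      simpa [hsG] using hik)
    (by
      intro s hs
      obtain rfl : s = 0 := by omega
      simpa [hsH] using hik)
    (by simpa [hsG] using hkj) (by simpa [hsH] using hkj) (by simpa [hsG] using hnadj)
    (by omega) (by simpa using hG') (by simpa using hH') (by simpa using hD)
  simp only [Nat.not_lt_zero, false_and, exists_false, Set.ofPred_false, Set.empty_union, if_true,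
    zero_add, one_ne_zero, if_false] at hC h1 h2
  refine hP ⟨i, k, j, ⟨?_, ?_⟩, hnadj, C, hC, h1, h2⟩
  · simp [hik.ne, hij, hkj.ne]
  · simp [hik, hkj]

theorem VStable.sameDiscriminated {H : AncestralGraph V} (hP : J.VStable)
    (hG : G.IsDAG) (hH : H.IsDAG) (hJG : J.OrderedStable G)
    (hJH : J.OrderedStable H) (hsG : G.skeleton = J.skeleton) (hsH : H.skeleton = J.skeleton)
    (hind : ∀ i j, i ≠ j → ¬ J.skeleton.Adj i j → ∃ D, J.Indep {i} {j} D) :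
    G.SameDiscriminated H := by
  intro p r y hinj hpy hadj hy h0 hd
  rw [hsG] at hadj hy h0
  rcases Nat.eq_zero_or_pos r with rfl | hr
  · have h1 := hadj 0 le_rfl
    have h2 := hpy 0 (by omega)
    exact ⟨hP.isCollider_of_isCollider hG.inducingClosed hJG hJH hsG hsH hind h1 hy h2 h0,
      hP.isCollider_of_isCollider hH.inducingClosed hJH hJG hsH hsG hind h1 hy h2 h0⟩
  · -- two adjacent nodes of a DAG cannot both be colliders
    obtain ⟨⟨h1, -⟩, h2, -⟩ := hd (r - 1) (by omega)
    rw [show r - 1 + 1 = r by omega, show r - 1 + 2 = r + 1 by omega] at h1 h2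
    exact ⟨fun h => absurd (h.1.resolve_right (hG _ _)) h1.2.not_arrow,
      fun h => absurd (h.1.resolve_right (hH _ _)) h2.2.not_arrow⟩

end IndependenceModel

/-! ### The two cases of the theorem -/

theorem theorem5p9 {V : Type*} [Finite V] {X : V → Type*} [∀ v, MeasurableSpace (X v)]
    (P : MeasureTheory.Measure (∀ v, X v)) [MeasureTheory.IsProbabilityMeasure P]
    (G₀ : AncestralGraph V)
    (hMarkov : (probIndepModel P).Markovian G₀)
    (hConverse : (probIndepModel P).ConversePairwiseMarkovian G₀)
    (hStable : (probIndepModel P).OrderedStable G₀) :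
    (G₀.IsMaximal → (probIndepModel P).PathStable →
      ∀ G : AncestralGraph V, (probIndepModel P).IsNaturalOutput G → G.IsMaximal →
        G.MarkovEquivalent G₀) ∧
    (G₀.IsDAG → (probIndepModel P).VStable →
      ∀ G : AncestralGraph V, (probIndepModel P).IsNaturalOutput G → G.IsDAG →
        G.MarkovEquivalent G₀) := by
  have hsk : G₀.IsMaximal → G₀.skeleton = (probIndepModel P).skeleton :=
    IndependenceModel.skeleton_eq_of_isMaximal hMarkov hConverse hStable
  have hind : G₀.IsMaximal → ∀ i j, i ≠ j → ¬ (probIndepModel P).skeleton.Adj i j →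
      ∃ D, (probIndepModel P).Indep {i} {j} D := by
    intro hG₀ i j hij hadj
    rw [← hsk hG₀] at hadj
    obtain ⟨C, hC⟩ := hG₀ i j hij hadj
    exact ⟨C, hMarkov _ _ _ hC⟩
  constructor
  · rintro hG₀ hP G ⟨hsG, hJG⟩ hG
    exact (hP.sameDiscriminated hG.inducingClosed hG₀.inducingClosed hJG hStable hsG (hsk hG₀)
      (hind hG₀)).markovEquivalent (hsG.trans (hsk hG₀).symm) hG.inducingClosed hG₀.inducingClosed
  · rintro hG₀ hP G ⟨hsG, hJG⟩ hG
    have hmax := hG₀.inducingClosed.isMaximal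
    exact (hP.sameDiscriminated hG hG₀ hJG hStable hsG (hsk hmax) (hind hmax)).markovEquivalent
      (hsG.trans (hsk hmax).symm) hG.inducingClosed hG₀.inducingClosed
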